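/- Let $d\ge 1$ and let $\mathcal O\subset\mathbb R^d$ be a bounded open set (for example a bounded smooth domain). Let $H^1_0$ be the closure of $C^1_c(\mathcal O)$ in $H^1(\mathcal O)$, with norm $\|u\|_{H^1_0}=\|\nabla u\|_{L^2}$, and let $H^{-1}$ be its topological dual with the dual norm. Let $\psi:\mathbb R\to[0,\infty)$ be convex and lower semicontinuous with $\psi(0)=0$ and $\psi(-x)=\psi(x)$ for all $x$, and let $\psi^*(x)=\sup_{y\in\mathbb R}(xy-\psi(y))\in[0,\infty]$. A function $v\in L^{m+1}(\mathcal O)$ (respectively a finite signed Radon measure $\mu$ on $\mathcal O$) is identified with $u\in H^{-1}$ if $u(\eta)=\int_{\mathcal O} v\eta\,dx$ (respectively $u(\eta)=\int_{\mathcal O}\eta\,d\mu$) for all $\eta\in C^1_c(\mathcal O)$; the set of such $u$ is denoted by $L^{m+1}\cap H^{-1}$ (respectively $\mathcal M\cap H^{-1}$). (i) (Superlinear case.) Suppose that $\psi(x)/|x|\to\infty$ as $|x|\to\infty$, and that $m\in(0,1]$ is such that, for measurable $v:\mathcal O\to\mathbb R$, $\psi(v)\in L^1(\mathcal O)$ if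 and only if $v\in L^{m+1}(\mathcal O)$. Then the functional $\varphi:H^{-1}\to[0,\infty]$, $$\varphi(u)=\int_{\mathcal O}\psi(u)\,dx\ \text{ if } u\in L^{m+1}\cap H^{-1},\qquad \varphi(u)=+\infty\ \text{ otherwise},$$ is convex and lower semicontinuous. (ii) (Sublinear case.) Suppose that there is $C>0$ with $\psi(x)\le C(1+|x|)$ for all $x\in\mathbb R$, and that $\psi(y)>0$ for some $y>0$. Then, for each finite signed Radon measure $\mu$ on $\mathcal O$, there is exactly one finite positive Radon measure $\psi(\mu)$ on $\mathcal O$ such that $$\int_{\mathcal O}\eta\,d\psi(\mu)=\sup\Big\{\int_{\mathcal O}v\eta\,d\mu-\int_{\mathcal O}\psi^*(v)\eta\,dx:\ v\in C_c(\mathcal O),\ \psi^*(v)\in L^1(\mathcal O)\Big\}$$ for all $\eta\ge 0$ in the space $C_0(\mathcal O)$ of continuous functions vanishing at the boundary, and the functional $\varphi:H^{-1}\to[0,\infty]$, $$\varphi(u)=\|\psi(u)\|_{TV}\ \text{ if } u\in\mathcal M\cap H^{-1},\qquad \varphi(u)=+\infty\ \text{ otherwise},$$ is convex and lower semicontinuous.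 -/

import Mathlib

open MeasureTheory TopologicalSpace Filter Set
open scoped ENNReal NNReal ZeroAtInfty CompactlySupported Distributions

noncomputable section

/-! ### The spaces `H¹₀(O)` and `H⁻¹(O)`

Throughout, `O` is an open subset of `ℝ^d`; function and measure spaces on `O` are taken on the
subtype `O`, with Lebesgue measure `vol O`. `𝓓^{1}(O, ℝ)` is Mathlib's space `C¹_c(O)`. -/

/-- `ℝ^d` with the Euclidean norm. -/
abbrev Rd (d : ℕ) : Type := EuclideanSpace ℝ (Fin d)

/-- Lebesgue measure on the open set `O ⊆ ℝ^d`, as a measure on the subtype `O`. -/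
abbrev vol {d : ℕ} (O : Opens (Rd d)) : Measure O :=
  Measure.comap Subtype.val (volume : Measure (Rd d))

section Sobolev

variable {d : ℕ} (O : Opens (Rd d))

theorem testFunction_memLp (η : 𝓓^{1}(O, ℝ)) :
    MemLp (fun x : O => η x) 2 (vol O) :=
  ((η.contDiff.continuous.memLp_of_hasCompactSupport η.hasCompactSupport).restrict
    (O : Set (Rd d))).comp_measurePreserving (measurePreserving_subtype_coe O.isOpen.measurableSet)

theorem testFunction_differentiable (η : 𝓓^{1}(O, ℝ)) : Differentiable ℝ (η : Rd d → ℝ) :=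
  η.contDiff.differentiable (by norm_num)

theorem testFunction_gradient_memLp (η : 𝓓^{1}(O, ℝ)) :
    MemLp (fun x : O => gradient η (x : Rd d)) 2 (vol O) := by
  have hc : Continuous (gradient (η : Rd d → ℝ)) :=
    (InnerProductSpace.toDual ℝ (Rd d)).symm.continuous.comp
      (η.contDiff.continuous_fderiv (by norm_num))
  have hs : HasCompactSupport (gradient (η : Rd d → ℝ)) :=
    (η.hasCompactSupport.fderiv ℝ).comp_left
      (map_zero (InnerProductSpace.toDual ℝ (Rd d)).symm)
  exact ((hc.memLp_of_hasCompactSupport hs).restrict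
    (O : Set (Rd d))).comp_measurePreserving (measurePreserving_subtype_coe O.isOpen.measurableSet)

/-- The map `η ↦ (η, ∇η)` from `C¹_c(O)` to `L²(O) × L²(O; ℝ^d)`. -/
def testGraph : 𝓓^{1}(O, ℝ) →ₗ[ℝ]
    Lp ℝ 2 (vol O) × Lp (Rd d) 2 (vol O) where
  toFun η := ((testFunction_memLp O η).toLp, (testFunction_gradient_memLp O η).toLp)
  map_add' η ξ := by
    refine Prod.ext ?_ ?_
    · exact MemLp.toLp_add (testFunction_memLp O η) (testFunction_memLp O ξ)
    · refine (MemLp.toLp_congr (testFunction_gradient_memLp O (η + ξ))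
        ((testFunction_gradient_memLp O η).add (testFunction_gradient_memLp O ξ))
        (Eventually.of_forall fun x => ?_)).trans
        (MemLp.toLp_add (testFunction_gradient_memLp O η) (testFunction_gradient_memLp O ξ))
      have h : fderiv ℝ (⇑(η + ξ)) (x : Rd d) = fderiv ℝ η (x : Rd d) + fderiv ℝ ξ (x : Rd d) :=
        fderiv_add (testFunction_differentiable O η _) (testFunction_differentiable O ξ _)
      change (InnerProductSpace.toDual ℝ (Rd d)).symm _ = _
      rw [h, map_add]
      rfl
  map_smul' c η := by
    refine Prod.ext ?_ ?_
    · exact MemLp.toLp_const_smul c (testFunction_memLp O η)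
    · refine (MemLp.toLp_congr (testFunction_gradient_memLp O (c • η))
        ((testFunction_gradient_memLp O η).const_smul c)
        (Eventually.of_forall fun x => ?_)).trans
        (MemLp.toLp_const_smul c (testFunction_gradient_memLp O η))
      have h : fderiv ℝ (⇑(c • η)) (x : Rd d) = c • fderiv ℝ η (x : Rd d) :=
        fderiv_const_smul (testFunction_differentiable O η _) c
      change (InnerProductSpace.toDual ℝ (Rd d)).symm _ = _
      rw [h, LinearIsometryEquiv.map_smulₛₗ]
      rfl

/-- `H¹₀(O)`: the closure of `C¹_c(O)` in `H¹(O)`. Its elements are stored as pairs `(u, ∇u)` in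
`L²(O) × L²(O; ℝ^d)`; the second entry is the weak gradient of the first one. -/
def H10 : Type := ↥((LinearMap.range (testGraph O)).topologicalClosure)

instance : AddCommGroup (H10 O) :=
  inferInstanceAs (AddCommGroup ↥((LinearMap.range (testGraph O)).topologicalClosure))

instance : Module ℝ (H10 O) :=
  inferInstanceAs (Module ℝ ↥((LinearMap.range (testGraph O)).topologicalClosure))

/-- The weak gradient `H¹₀(O) → L²(O; ℝ^d)`. -/
def H10.grad : H10 O →ₗ[ℝ] Lp (Rd d) 2 (vol O) :=
  (LinearMap.snd ℝ _ _).comp ((LinearMap.range (testGraph O)).topologicalClosure).subtype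

/-- `H¹₀(O)` carries `‖u‖ = ‖∇u‖_{L²}` (definite for bounded `O`, by Poincaré's inequality). -/
instance : SeminormedAddCommGroup (H10 O) :=
  SeminormedAddCommGroup.induced (H10 O) (Lp (Rd d) 2 (vol O)) (H10.grad O)

instance : NormedSpace ℝ (H10 O) :=
  NormedSpace.induced ℝ (H10 O) (Lp (Rd d) 2 (vol O)) (H10.grad O)

/-- The inclusion `C¹_c(O) → H¹₀(O)`. -/
def H10.ofTest : 𝓓^{1}(O, ℝ) →ₗ[ℝ] H10 O :=
  (testGraph O).codRestrict ((LinearMap.range (testGraph O)).topologicalClosure)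
    fun η => Submodule.le_topologicalClosure _ (LinearMap.mem_range_self _ η)

/-- `H⁻¹(O)`: the topological dual of `H¹₀(O)`, with the dual norm. -/
abbrev HNegOne : Type := StrongDual ℝ (H10 O)

end Sobolev

section Energy

variable {d : ℕ} {O : Opens (Rd d)}

/-- The functional `u ∈ H⁻¹(O)` is the (extension to `H¹₀(O)` of the) functional
`η ↦ ∫ v η dx` on `C¹_c(O)`. -/
def IsGivenByFunction (u : HNegOne O) (v : O → ℝ) : Prop :=
  ∀ η : 𝓓^{1}(O, ℝ), u (H10.ofTest O η) = ∫ x, v x * η x ∂(vol O)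

/-- The functional `u ∈ H⁻¹(O)` is the (extension to `H¹₀(O)` of the) functional
`η ↦ ∫ η dμ` on `C¹_c(O)`. -/
def IsGivenByMeasure (u : HNegOne O) (μ : SignedMeasure O) : Prop :=
  ∀ η : 𝓓^{1}(O, ℝ), u (H10.ofTest O η) = ∫ᵛ x : O, η x ∂<•μ

/-! ### The potential -/

/-- A potential: a convex, lower semicontinuous, symmetric function `ψ : ℝ → [0, ∞)` with
`ψ(0) = 0`. -/
structure IsPotential (ψ : ℝ → ℝ) : Prop where
  nonneg : ∀ x, 0 ≤ ψ x
  convexOn : ConvexOn ℝ univ ψ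
  lowerSemicontinuous : LowerSemicontinuous ψ
  map_zero : ψ 0 = 0
  symm : ∀ x, ψ (-x) = ψ x

/-- `ψ(x) / |x| → ∞` as `|x| → ∞`. -/
def IsSuperlinear (ψ : ℝ → ℝ) : Prop :=
  Tendsto (fun x => ψ x / |x|) (cocompact ℝ) atTop

/-- For (classes of) measurable functions `v` on `O`: `ψ(v) ∈ L¹(O)` if and only if
`v ∈ L^{m+1}(O)`. -/
def HasIntegrabilityExponent (O : Opens (Rd d)) (ψ : ℝ → ℝ) (m : ℝ) : Prop :=
  ∀ v : O → ℝ, AEStronglyMeasurable v (vol O) →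
    (Integrable (fun x => ψ (v x)) (vol O) ↔
      MemLp v (ENNReal.ofReal (m + 1)) (vol O))

/-- `ψ(x) ≤ C (1 + |x|)` for all `x`, for some constant `C > 0`. -/
def IsSublinear (ψ : ℝ → ℝ) : Prop :=
  ∃ C : ℝ, 0 < C ∧ ∀ x, ψ x ≤ C * (1 + |x|)

/-- The convex conjugate `ψ*(x) = sup_y (x y - ψ(y))`, with values in `[0, ∞]`. As `ψ(0) = 0`, the
supremum is nonnegative, so that replacing its members by their positive parts changes nothing. -/
def convexConjugate (ψ : ℝ → ℝ) (x : ℝ) : ℝ≥0∞ :=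
  ⨆ y : ℝ, ENNReal.ofReal (x * y - ψ y)

/-! ### Convex functions of measures -/

/-- `D_ψ`: the functions `v ∈ C_c(O)` with `ψ*(v) ∈ L¹(O)`. -/
def conjugateDomain (O : Opens (Rd d)) (ψ : ℝ → ℝ) : Set C_c(O, ℝ) :=
  {v | ∫⁻ x, convexConjugate ψ (v x) ∂(vol O) < ∞}

/-- The finite positive Borel measure `ν` on `O` is the convex function `ψ(μ)` of the measure `μ`:
`∫ η dν = sup {∫ v η dμ - ∫ ψ*(v) η dx : v ∈ D_ψ}` for all `η ∈ C₀(O)` with `η ≥ 0`. -/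
def IsConvexFunctionOfMeasure (ψ : ℝ → ℝ) (μ : SignedMeasure O) (ν : Measure O) : Prop :=
  IsFiniteMeasure ν ∧ ∀ η : C₀(O, ℝ), (∀ x, 0 ≤ η x) →
    IsLUB ((fun v : C_c(O, ℝ) => (∫ᵛ x : O, v x * η x ∂<•μ) -
        (∫⁻ x, convexConjugate ψ (v x) * ENNReal.ofReal (η x) ∂(vol O)).toReal) ''
      conjugateDomain O ψ) (∫ x : O, η x ∂ν)

open Classical in
/-- The positive measure `ψ(μ)`. -/
def convexFunctionOfMeasure (ψ : ℝ → ℝ) (μ : SignedMeasure O) : Measure O :=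
  if h : ∃ ν : Measure O, IsConvexFunctionOfMeasure ψ μ ν then h.choose else 0

/-! ### The energy functionals -/

open Classical in
/-- The energy functional for a superlinear potential: `φ(u) = ∫ ψ(u) dx` if
`u ∈ L^{m+1}(O) ∩ H⁻¹(O)`, and `φ(u) = ∞` otherwise. The function in `L^{m+1}(O)` that gives `u`
is unique. -/
def energySuperlinear (O : Opens (Rd d)) (ψ : ℝ → ℝ) (m : ℝ) (u : HNegOne O) : ℝ≥0∞ :=
  if h : ∃ v : Lp ℝ (ENNReal.ofReal (m + 1)) (vol O), IsGivenByFunction u v then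
    ∫⁻ x, ENNReal.ofReal (ψ (h.choose x)) ∂(vol O)
  else ∞

open Classical in
/-- The energy functional for a sublinear potential: `φ(u) = ‖ψ(u)‖_TV` if `u ∈ M(O) ∩ H⁻¹(O)`,
and `φ(u) = ∞` otherwise. The measure that gives `u` is unique, and the total variation of the
positive measure `ψ(u)` is its mass. -/
def energySublinear (O : Opens (Rd d)) (ψ : ℝ → ℝ) (u : HNegOne O) : ℝ≥0∞ :=
  if h : ∃ μ : SignedMeasure O, IsGivenByMeasure u μ then
    convexFunctionOfMeasure ψ h.choose univ
  else ∞

end Energy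

end

/-! The two cases rest on one duality formula. Let `R` be the slope of `ψ` at infinity in the
sublinear case. Write `μ = h l` and `dx = k l` with a common finite measure `l`. Then `ψ(μ)` has
density `perspective ψ R h k` with respect to `l`: this is `ψ` of the absolutely continuous density,
plus `R` times the variation of the singular part, which lives on `k = 0`. Young's inequality bounds
`s h - ψ*(s) k` by the perspective, with near equality for `s = θ * perspectiveSlope`, `θ < 1`. The
factor `θ` keeps `s` in a compact part of `(-R, R)`, where `ψ*` is finite and continuous, so bounded
approximation by test functions and dominated convergence apply
(`HasDensities.exists_lt_integral_sub`).

Consequently, for every `u` given by a measure, the sublinear energy equals `dualEnergy`, a supremum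
of continuous affine functions of `u`; convexity follows. For lower semicontinuity it remains to see
that limits of bounded energy are still given by measures. The perspective controls `|h|` up to a
multiple of `k`, so such `u` have representing measures of bounded mass, and a vague limit of these
represents the limit functional.

A superlinear `ψ` is the increasing limit of sublinear potentials `Ψ n` whose slopes at infinity are
unbounded. The superlinear energy is the supremum of the corresponding sublinear energies
(`energySuperlinear_eq_iSup`): a bound on all of them excludes a singular part, monotone convergence
gives `ψ(v) ∈ L¹`, and the integrability hypothesis turns this into `v ∈ L^{m+1}`. Convexity and
lower semicontinuity pass to suprema. -/

open scoped Topology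

/-! ### Convex analysis of potentials -/

/-- A subgradient of `ψ` at `x`: the right derivative. -/
noncomputable def subgradient (ψ : ℝ → ℝ) (x : ℝ) : ℝ := derivWithin ψ (Ioi x) x

namespace IsPotential

variable {ψ : ℝ → ℝ}

theorem continuous (hψ : IsPotential ψ) : Continuous ψ :=
  hψ.convexOn.locallyLipschitz.continuous

theorem map_mul_le (hψ : IsPotential ψ) {t : ℝ} (ht0 : 0 ≤ t) (ht1 : t ≤ 1) (x : ℝ) :
    ψ (t * x) ≤ t * ψ x := by
  have h := hψ.convexOn.2 (mem_univ x) (mem_univ 0) ht0 (sub_nonneg.2 ht1) (by ring)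
  simpa [hψ.map_zero] using h

theorem map_abs (hψ : IsPotential ψ) (x : ℝ) : ψ |x| = ψ x := by
  rcases abs_choice x with h | h <;> rw [h]
  exact hψ.symm x

theorem slope_mono (hψ : IsPotential ψ) {x y : ℝ} (hx : 0 < x) (hxy : x ≤ y) :
    ψ x / x ≤ ψ y / y := by
  have hy : 0 < y := hx.trans_le hxy
  have h := hψ.map_mul_le (t := x / y) (by positivity) ((div_le_one hy).2 hxy) y
  rw [div_mul_cancel₀ _ hy.ne'] at h
  rw [div_le_div_iff₀ hx hy]
  calc ψ x * y ≤ x / y * ψ y * y := by gcongr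
    _ = ψ y * x := by field_simp

theorem monotone_subgradient (hψ : IsPotential ψ) : Monotone (subgradient ψ) := by
  have h := hψ.convexOn.monotoneOn_rightDeriv
  rw [interior_univ, monotoneOn_univ] at h
  exact h

/-- The right derivative at `x` is at most every slope to the right of `x` and, dominating the left
derivative, at least every slope to the left. Thus `x` maximizes `y ↦ s y - ψ y`, and the supremum
defining `ψ*(s)` is attained there. -/
theorem subgradient_le (hψ : IsPotential ψ) (x y : ℝ) :
    subgradient ψ x * y - ψ y ≤ subgradient ψ x * x - ψ x := by
  have hx : x ∈ interior (univ : Set ℝ) := by simp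
  rcases lt_trichotomy x y with h | rfl | h
  · have h1 := hψ.convexOn.rightDeriv_le_slope_of_mem_interior hx (mem_univ y) h
    rw [slope_def_field, le_div_iff₀ (by linarith)] at h1
    change subgradient ψ x * _ ≤ _ at h1
    linarith
  · rfl
  · have h1 := hψ.convexOn.slope_le_leftDeriv_of_mem_interior (mem_univ y) hx h
    have h2 := hψ.convexOn.leftDeriv_le_rightDeriv_of_mem_interior hx
    have h3 : slope ψ y x ≤ subgradient ψ x := h1.trans h2
    rw [slope_def_field, div_le_iff₀ (by linarith)] at h3
    linarith

end IsPotential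

/-- The number `R` is the slope of `ψ` at infinity. -/
structure IsRecessionSlope (ψ : ℝ → ℝ) (R : ℝ) : Prop where
  pos : 0 < R
  le : ∀ x, ψ x ≤ R * |x|
  exists_lt : ∀ r < R, ∃ x, 0 < x ∧ r * x < ψ x

/-- `R` is the supremum of the quotients `ψ x / x` over `x > 0`. They increase in `x`, so linear
growth bounds all of them, and positivity of `ψ` somewhere makes `R` positive. -/
theorem IsPotential.exists_isRecessionSlope {ψ : ℝ → ℝ} (hψ : IsPotential ψ)
    (hs : IsSublinear ψ) (hy : ∃ y : ℝ, 0 < y ∧ 0 < ψ y) : ∃ R, IsRecessionSlope ψ R := by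
  obtain ⟨C, hC, hle⟩ := hs
  obtain ⟨y, hy0, hy⟩ := hy
  have hbound : ∀ x : ℝ, 0 < x → ψ x / x ≤ C := by
    intro x hx
    by_contra! hlt
    set s := ψ x / x
    -- A slope `s > C` persists beyond `x`; at this `z`, `(s - C) z > C`, which violates `ψ z ≤ C (1
    -- + z)`.
    have hz : x ≤ max x (C / (s - C) + 1) := le_max_left _ _
    set z := max x (C / (s - C) + 1)
    have hz0 : 0 < z := hx.trans_le hz
    have h1 : s * z ≤ ψ z := (le_div_iff₀ hz0).1 (hψ.slope_mono hx hz)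
    have h2 := hle z
    rw [abs_of_pos hz0] at h2
    have h3 : C / (s - C) < z := (lt_add_one _).trans_le (le_max_right _ _)
    rw [div_lt_iff₀ (by linarith)] at h3
    linarith
  have hbdd : BddAbove ((fun x => ψ x / x) '' Ioi (0 : ℝ)) :=
    ⟨C, by rintro _ ⟨x, hx, rfl⟩; exact hbound x hx⟩
  have hle' : ∀ x : ℝ, 0 < x → ψ x / x ≤ sSup ((fun x => ψ x / x) '' Ioi (0 : ℝ)) :=
    fun x hx => le_csSup hbdd ⟨x, hx, rfl⟩
  refine ⟨sSup ((fun x => ψ x / x) '' Ioi (0 : ℝ)), ?_, ?_, ?_⟩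
  · exact (div_pos hy hy0).trans_le (hle' y hy0)
  · intro x
    rcases eq_or_ne x 0 with rfl | hx
    · simp [hψ.map_zero]
    · have := hle' |x| (abs_pos.2 hx)
      rwa [div_le_iff₀ (abs_pos.2 hx), hψ.map_abs] at this
  · intro r hr
    obtain ⟨_, ⟨x, hx, rfl⟩, hlt⟩ := exists_lt_of_lt_csSup
      (⟨_, mem_image_of_mem _ (mem_Ioi.2 hy0)⟩ :
        ((fun x => ψ x / x) '' Ioi (0 : ℝ)).Nonempty) hr
    exact ⟨x, hx, (lt_div_iff₀ hx).1 hlt⟩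

/-! ### The convex conjugate and its domain -/

section Conjugate

variable {ψ : ℝ → ℝ} {R : ℝ}

theorem mul_sub_le_toReal_convexConjugate {s : ℝ} (hs : convexConjugate ψ s ≠ ∞) (y : ℝ) :
    s * y - ψ y ≤ (convexConjugate ψ s).toReal :=
  (ENNReal.ofReal_le_iff_le_toReal hs).1 (le_iSup (fun y => ENNReal.ofReal (s * y - ψ y)) y)

theorem convexConjugate_le {s B : ℝ} (h : ∀ y, s * y - ψ y ≤ B) :
    convexConjugate ψ s ≤ ENNReal.ofReal B :=
  iSup_le fun y => ENNReal.ofReal_le_ofReal (h y)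

theorem measurable_convexConjugate (ψ : ℝ → ℝ) : Measurable (convexConjugate ψ) := by
  refine LowerSemicontinuous.measurable (lowerSemicontinuous_iSup fun y => ?_)
  exact (ENNReal.continuous_ofReal.comp (by fun_prop)).lowerSemicontinuous

theorem IsPotential.convexConjugate_subgradient_le (hψ : IsPotential ψ) (x : ℝ) :
    convexConjugate ψ (subgradient ψ x) ≤ ENNReal.ofReal (subgradient ψ x * x - ψ x) :=
  convexConjugate_le (hψ.subgradient_le x)

theorem IsPotential.convexConjugate_subgradient_ne_top (hψ : IsPotential ψ) (x : ℝ) :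
    convexConjugate ψ (subgradient ψ x) ≠ ∞ :=
  ne_top_of_le_ne_top ENNReal.ofReal_ne_top (hψ.convexConjugate_subgradient_le x)

theorem IsPotential.toReal_convexConjugate_subgradient (hψ : IsPotential ψ) (x : ℝ) :
    (convexConjugate ψ (subgradient ψ x)).toReal = subgradient ψ x * x - ψ x := by
  refine le_antisymm (ENNReal.toReal_le_of_le_ofReal ?_ (hψ.convexConjugate_subgradient_le x))
    (mul_sub_le_toReal_convexConjugate (hψ.convexConjugate_subgradient_ne_top x) x)
  have := hψ.subgradient_le x 0
  simpa [hψ.map_zero] using this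

theorem IsPotential.convexConjugate_mono (hψ : IsPotential ψ) {s t : ℝ} (hst : |s| ≤ |t|) :
    convexConjugate ψ s ≤ convexConjugate ψ t := by
  refine iSup_le fun y => ?_
  have key : s * y ≤ |t| * |y| :=
    (le_abs_self _).trans ((abs_mul s y).le.trans (by gcongr))
  rcases abs_choice t with h | h
  · refine le_iSup_of_le |y| (ENNReal.ofReal_le_ofReal ?_)
    rw [hψ.map_abs, ← h]
    linarith
  · refine le_iSup_of_le (-|y|) (ENNReal.ofReal_le_ofReal ?_)
    rw [hψ.symm, hψ.map_abs]
    rw [h] at key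
    linarith

theorem IsRecessionSlope.abs_le (hR : IsRecessionSlope ψ R) (hψ : IsPotential ψ) {s : ℝ}
    (hs : convexConjugate ψ s ≠ ∞) : |s| ≤ R := by
  by_contra! hlt
  have hs' : convexConjugate ψ |s| ≠ ∞ := ne_top_of_le_ne_top hs (hψ.convexConjugate_mono (by simp))
  set B := (convexConjugate ψ |s|).toReal
  have hB : 0 ≤ B := ENNReal.toReal_nonneg
  have hpos : 0 < |s| - R := by linarith
  -- At this point `|s| y - R y = B + 1`, more than the supposed value `B` of the conjugate.
  have h1 := mul_sub_le_toReal_convexConjugate hs' ((B + 1) / (|s| - R))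
  have h2 := hR.le ((B + 1) / (|s| - R))
  have hq : 0 ≤ (B + 1) / (|s| - R) := div_nonneg (by linarith) hpos.le
  rw [abs_of_nonneg hq] at h2
  have h3 : (|s| - R) * ((B + 1) / (|s| - R)) = B + 1 := by field_simp
  linarith

/-- Past some `x` the quotients of `ψ` exceed `|s|`, so `s y - ψ y ≤ 0` there; for `|y| ≤ x` it is
at most `|s| x`. -/
theorem IsRecessionSlope.convexConjugate_ne_top (hR : IsRecessionSlope ψ R) (hψ : IsPotential ψ)
    {s : ℝ} (hs : |s| < R) : convexConjugate ψ s ≠ ∞ := by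
  obtain ⟨x, hx, hlt⟩ := hR.exists_lt _ hs
  refine ne_top_of_le_ne_top (ENNReal.ofReal_ne_top (r := |s| * x))
    (convexConjugate_le fun y => ?_)
  have h1 : s * y ≤ |s| * |y| := (le_abs_self _).trans (abs_mul s y).le
  rcases le_total |y| x with h | h
  · have := hψ.nonneg y
    have : |s| * |y| ≤ |s| * x := by gcongr
    linarith
  · have h2 := hψ.slope_mono hx h
    have h3 : |s| ≤ ψ |y| / |y| := ((le_div_iff₀ hx).2 hlt.le).trans h2
    rw [le_div_iff₀ (hx.trans_le h), hψ.map_abs] at h3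
    have : 0 ≤ |s| * x := by positivity
    linarith

theorem IsPotential.toReal_convexConjugate_mul_le (hψ : IsPotential ψ) {s θ : ℝ}
    (hs : convexConjugate ψ s ≠ ∞) (h0 : 0 ≤ θ) (h1 : θ ≤ 1) :
    (convexConjugate ψ (θ * s)).toReal ≤ θ * (convexConjugate ψ s).toReal := by
  refine ENNReal.toReal_le_of_le_ofReal (by positivity) (convexConjugate_le fun y => ?_)
  have := mul_sub_le_toReal_convexConjugate hs y
  have h2 := mul_le_mul_of_nonneg_left this h0
  have h3 : θ * ψ y ≤ ψ y := mul_le_of_le_one_left (hψ.nonneg y) h1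
  linarith

theorem IsRecessionSlope.continuousOn_toReal_convexConjugate (hR : IsRecessionSlope ψ R)
    (hψ : IsPotential ψ) :
    ContinuousOn (fun s => (convexConjugate ψ s).toReal) (Ioo (-R) R) := by
  refine ConvexOn.continuousOn isOpen_Ioo ⟨convex_Ioo _ _, ?_⟩
  intro s hs t ht a b ha hb hab
  have hs' := hR.convexConjugate_ne_top hψ (abs_lt.2 hs)
  have ht' := hR.convexConjugate_ne_top hψ (abs_lt.2 ht)
  refine ENNReal.toReal_le_of_le_ofReal (by positivity) (convexConjugate_le fun y => ?_)
  have h1 := mul_le_mul_of_nonneg_left (mul_sub_le_toReal_convexConjugate hs' y) ha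
  have h2 := mul_le_mul_of_nonneg_left (mul_sub_le_toReal_convexConjugate ht' y) hb
  have h3 : ψ y = a * ψ y + b * ψ y := by rw [← add_mul, hab, one_mul]
  simp only [smul_eq_mul]
  linarith

end Conjugate

/-! ### The perspective function -/

/-- The perspective `(h, k) ↦ k ψ(h / k)` of `ψ`, equal to `R |h|` for `k = 0`. -/
noncomputable def perspective (ψ : ℝ → ℝ) (R h k : ℝ) : ℝ :=
  if k = 0 then R * |h| else k * ψ (h / k)

/-- A maximizer of `s ↦ s h - ψ*(s) k`. -/
noncomputable def perspectiveSlope (ψ : ℝ → ℝ) (R h k : ℝ) : ℝ :=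
  if k = 0 then R * SignType.sign h else subgradient ψ (h / k)

section Perspective

variable {ψ : ℝ → ℝ} {R : ℝ}

theorem perspective_nonneg (hψ : IsPotential ψ) (hR : IsRecessionSlope ψ R) {h k : ℝ}
    (hk : 0 ≤ k) : 0 ≤ perspective ψ R h k := by
  unfold perspective
  split_ifs
  · exact mul_nonneg hR.pos.le (abs_nonneg _)
  · exact mul_nonneg hk (hψ.nonneg _)

theorem perspective_le (hR : IsRecessionSlope ψ R) {h k : ℝ}
    (hk : 0 ≤ k) : perspective ψ R h k ≤ R * |h| := by
  unfold perspective
  split_ifs with h0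
  · rfl
  · have hk' : 0 < k := lt_of_le_of_ne hk (Ne.symm h0)
    calc k * ψ (h / k) ≤ k * (R * |h / k|) := by gcongr; exact hR.le _
      _ = R * |h| := by rw [abs_div, abs_of_pos hk']; field_simp

theorem measurable_perspective (hψ : IsPotential ψ) (R : ℝ) {X : Type*} [MeasurableSpace X]
    {h k : X → ℝ} (hh : Measurable h) (hk : Measurable k) :
    Measurable fun x => perspective ψ R (h x) (k x) := by
  unfold perspective
  have := hψ.continuous.measurable
  exact Measurable.ite (hk (measurableSet_singleton 0)) (by fun_prop) (by fun_prop)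

theorem measurable_perspectiveSlope (hψ : IsPotential ψ) (R : ℝ) {X : Type*} [MeasurableSpace X]
    {h k : X → ℝ} (hh : Measurable h) (hk : Measurable k) :
    Measurable fun x => perspectiveSlope ψ R (h x) (k x) := by
  unfold perspectiveSlope
  have h1 := hψ.monotone_subgradient.measurable
  have h2 : Measurable fun y : ℝ => ((SignType.sign y : SignType) : ℝ) := by
    have : (fun y : ℝ => ((SignType.sign y : SignType) : ℝ)) =
        fun y => if 0 < y then 1 else if y < 0 then -1 else 0 := by
      ext y
      rw [sign_apply]
      split_ifs <;> simp
    rw [this]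
    exact Measurable.ite measurableSet_Ioi measurable_const
      (Measurable.ite measurableSet_Iio measurable_const measurable_const)
  exact Measurable.ite (hk (measurableSet_singleton 0)) ((h2.comp hh).const_mul R)
    (h1.comp (hh.div hk))

theorem abs_perspectiveSlope_le (hψ : IsPotential ψ) (hR : IsRecessionSlope ψ R) (h k : ℝ) :
    |perspectiveSlope ψ R h k| ≤ R := by
  unfold perspectiveSlope
  split_ifs
  · rw [abs_mul, abs_of_pos hR.pos]
    rcases lt_trichotomy h 0 with h0 | rfl | h0 <;> simp [*, hR.pos.le]
  · exact hR.abs_le hψ (hψ.convexConjugate_subgradient_ne_top _)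

/-- Young's inequality in homogeneous form. Finiteness of `ψ*(s)` is asked only for `k ≠ 0`: on the
singular set the conjugate may be infinite, but its term is multiplied by zero and only `|s| ≤ R`
matters. -/
theorem mul_sub_convexConjugate_mul_le_perspective
    {s h k : ℝ} (hsR : |s| ≤ R) (hs : k ≠ 0 → convexConjugate ψ s ≠ ∞) (hk : 0 ≤ k) :
    s * h - (convexConjugate ψ s).toReal * k ≤ perspective ψ R h k := by
  unfold perspective
  split_ifs with h0
  · rw [h0, mul_zero, sub_zero]
    calc s * h ≤ |s| * |h| := (le_abs_self _).trans (abs_mul s h).le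
      _ ≤ R * |h| := by gcongr
  · have h1 := mul_le_mul_of_nonneg_left (mul_sub_le_toReal_convexConjugate (hs h0) (h / k)) hk
    have h2 : k * (s * (h / k) - ψ (h / k)) = s * h - k * ψ (h / k) := by field_simp
    linarith

/-- At `θ = 1` the slope attains equality in Young's inequality. Scaling it by `θ` costs at most the
factor `θ`, since `ψ*(θ s) ≤ θ ψ*(s)`. -/
theorem mul_perspective_le (hψ : IsPotential ψ) {h k θ : ℝ}
    (hk : 0 ≤ k) (h0 : 0 ≤ θ) (h1 : θ ≤ 1) :
    θ * perspective ψ R h k ≤ θ * perspectiveSlope ψ R h k * h -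
      (convexConjugate ψ (θ * perspectiveSlope ψ R h k)).toReal * k := by
  unfold perspective perspectiveSlope
  split_ifs with hk0
  · rw [hk0, mul_zero, sub_zero]
    apply le_of_eq
    linear_combination (- θ * R) * sign_mul_self h
  · have h2 := hψ.toReal_convexConjugate_mul_le
      (hψ.convexConjugate_subgradient_ne_top (h / k)) h0 h1
    rw [hψ.toReal_convexConjugate_subgradient] at h2
    have h3 := mul_le_mul_of_nonneg_right h2 hk
    have h4 : θ * (subgradient ψ (h / k) * (h / k) - ψ (h / k)) * k =
      θ * subgradient ψ (h / k) * h - θ * (k * ψ (h / k)) := by field_simp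
    linarith

/-- Coercivity: Young's inequality for `|h|` with the fixed slope `s = R / 2`, which is interior to
the domain of `ψ*`; hence `c = R / 2` and `B = ψ*(R / 2)`. -/
theorem exists_mul_abs_le_perspective (hψ : IsPotential ψ) (hR : IsRecessionSlope ψ R) :
    ∃ c B : ℝ, 0 < c ∧ 0 ≤ B ∧ ∀ h k : ℝ, 0 ≤ k → c * |h| ≤ perspective ψ R h k + B * k := by
  have hpos := hR.pos
  refine ⟨R / 2, (convexConjugate ψ (R / 2)).toReal, by positivity, ENNReal.toReal_nonneg,
    fun h k hk => ?_⟩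
  have habs : |R / 2| < R := by rw [abs_of_pos (by positivity)]; linarith
  have hs := hR.convexConjugate_ne_top hψ habs
  have h1 := mul_sub_convexConjugate_mul_le_perspective (h := |h|) habs.le (fun _ => hs) hk
  have h2 : perspective ψ R |h| k = perspective ψ R h k := by
    unfold perspective
    rw [abs_abs]
    split_ifs
    · rfl
    · rw [← hψ.map_abs (h / k), abs_div, abs_of_nonneg hk]
  linarith

end Perspective

/-! ### Approximation by test functions -/

section Approximation

variable {d : ℕ} {O : Opens (Rd d)}

instance : LocallyCompactSpace O := O.isOpen.locallyCompactSpace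

/-- The restriction to `O` of a test function. -/
noncomputable def testFunctionRestrict (η : 𝓓^{1}(O, ℝ)) : C_c(O, ℝ) where
  toFun x := η x
  continuous_toFun := η.continuous.comp continuous_subtype_val
  hasCompactSupport' := by
    have h : IsCompact ((↑) ⁻¹' tsupport η : Set O) := by
      have e : ((↑) : O → Rd d) '' ((↑) ⁻¹' tsupport η) = tsupport η :=
        image_preimage_eq_of_subset fun x hx => ⟨⟨x, η.tsupport_subset hx⟩, rfl⟩
      refine Topology.IsInducing.subtypeVal.isCompact_iff.2 ?_
      exact e.symm ▸ η.hasCompactSupport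
    exact HasCompactSupport.intro h fun x hx => by
      by_contra h0
      exact hx (subset_tsupport _ h0)

/-- Density of `C_c` in `L¹` costs `ε`; clipping to `[-c, c]` costs nothing because `g` takes values
there. Smoothing and rescaling then cost `ε` each in the uniform norm, hence the term `2 ε l(O)`. -/
theorem exists_testFunction_integral_sub_le (l : Measure O) [IsFiniteMeasure l] {g : O → ℝ}
    (hg : Measurable g) {c : ℝ} (hc : 0 < c) (hgc : ∀ x, |g x| ≤ c) {ε : ℝ} (hε : 0 < ε) :
    ∃ ξ : 𝓓^{1}(O, ℝ), (∀ x, |ξ x| ≤ c) ∧ ∫ x : O, |ξ x - g x| ∂l ≤ ε + 2 * ε * l.real univ := by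
  have hgi : Integrable g l :=
    Integrable.of_bound hg.aestronglyMeasurable c (Eventually.of_forall hgc)
  obtain ⟨v, hv_supp, hv, hv_cont, hvi⟩ := hgi.exists_hasCompactSupport_integral_sub_le hε
  let w : O → ℝ := fun x => max (-c) (min c (v x))
  have hw_cont : Continuous w := by fun_prop
  have hw_supp : HasCompactSupport w :=
    hv_supp.comp_left (g := fun y => max (-c) (min c y)) (by simp [hc.le])
  have hw_abs : ∀ x, |w x| ≤ c := fun x =>
    abs_le.2 ⟨le_max_left _ _, max_le (by linarith) (min_le_left _ _)⟩
  have hw_ext : Continuous (Function.extend Subtype.val w 0 : Rd d → ℝ) :=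
    HasCompactSupport.continuous_extend_zero O.isOpen hw_cont hw_supp
  obtain ⟨s, hs, hs_dist, hs_supp⟩ := hw_ext.exists_contDiff_approx 1 (ε := fun _ => ε)
    continuous_const fun _ => hε
  have hext_abs : ∀ x, |(Function.extend Subtype.val w 0 : Rd d → ℝ) x| ≤ c := by
    intro x
    by_cases hx : ∃ y : O, (y : Rd d) = x
    · obtain ⟨y, rfl⟩ := hx
      rw [Subtype.val_injective.extend_apply]
      exact hw_abs y
    · rw [Function.extend_apply' _ _ _ hx]
      simpa using hc.le
  have hs_abs : ∀ x, |s x| ≤ c + ε := by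
    intro x
    have h1 := hs_dist x
    rw [Real.dist_eq] at h1
    have h2 := abs_sub_abs_le_abs_sub (s x) ((Function.extend Subtype.val w 0 : Rd d → ℝ) x)
    linarith [hext_abs x]
  have hcε : 0 < c + ε := by linarith
  -- The smooth approximation may exceed `c` by up to `ε`; this factor restores the bound and moves
  -- the values by at most `ε`.
  let f : Rd d → ℝ := fun x => c / (c + ε) * s x
  have hf_tsupp : tsupport f ⊆ tsupport (Function.extend Subtype.val w 0 : Rd d → ℝ) := by
    refine closure_mono (Subset.trans ?_ hs_supp)
    intro x hx h0
    exact hx (by simp [f, h0])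
  let ξ : 𝓓^{1}(O, ℝ) :=
    { toFun := f
      contDiff' := contDiff_const.mul hs
      hasCompactSupport' :=
        (hw_supp.extend_zero continuous_subtype_val).of_isClosed_subset (isClosed_tsupport _)
          hf_tsupp
      tsupport_subset' := hf_tsupp.trans
        ((hw_supp.tsupport_extend_zero_subset continuous_subtype_val).trans
          (Subtype.coe_image_subset _ _)) }
  have hξ : ∀ x, ξ x = c / (c + ε) * s x := fun x => rfl
  have hdiff : ∀ x : O, |ξ x - g x| ≤ ‖g x - v x‖ + 2 * ε := by
    intro x
    have h1 : |ξ x - s x| ≤ ε := by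
      have : ξ x - s x = - (ε / (c + ε) * s x) := by rw [hξ]; field_simp; ring
      rw [this, abs_neg, abs_mul, abs_of_pos (by positivity)]
      calc ε / (c + ε) * |s x| ≤ ε / (c + ε) * (c + ε) := by gcongr; exact hs_abs x
        _ = ε := by field_simp
    have h2 : |s x - w x| ≤ ε := by
      have := (hs_dist x).le
      rwa [Real.dist_eq, Subtype.val_injective.extend_apply] at this
    have h3 : |w x - g x| ≤ ‖g x - v x‖ := by
      have hgx := abs_le.1 (hgc x)
      rw [Real.norm_eq_abs, abs_sub_comm (g x)]
      have : g x = max (-c) (min c (g x)) := by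
        rw [min_eq_right hgx.2, max_eq_right hgx.1]
      calc |w x - g x| = |max (-c) (min c (v x)) - max (-c) (min c (g x))| := by rw [← this]
        _ ≤ |min c (v x) - min c (g x)| := by
            have := abs_max_sub_max_le_abs (min c (v x)) (min c (g x)) (-c)
            rwa [max_comm, max_comm (min c (g x))] at this
        _ ≤ |v x - g x| := by
            have := abs_min_sub_min_le_max c (v x) c (g x)
            simpa using this
    calc |ξ x - g x| = |(ξ x - s x) + (s x - w x) + (w x - g x)| := by ring_nf
      _ ≤ |ξ x - s x| + |s x - w x| + |w x - g x| := abs_add_three _ _ _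
      _ ≤ ‖g x - v x‖ + 2 * ε := by linarith
  refine ⟨ξ, fun x => ?_, ?_⟩
  · rw [hξ, abs_mul, abs_of_pos (by positivity)]
    calc c / (c + ε) * |s x| ≤ c / (c + ε) * (c + ε) := by gcongr; exact hs_abs x
      _ = c := by field_simp
  · have hi : Integrable (fun x => ‖g x - v x‖) l := (hgi.sub hvi).norm
    calc ∫ x : O, |ξ x - g x| ∂l ≤ ∫ x, (‖g x - v x‖ + 2 * ε) ∂l :=
          integral_mono_of_nonneg (Eventually.of_forall fun _ => abs_nonneg _)
            (hi.add (integrable_const _)) (Eventually.of_forall hdiff)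
      _ = ∫ x, ‖g x - v x‖ ∂l + 2 * ε * l.real univ := by
          rw [integral_add hi (integrable_const _), integral_const, smul_eq_mul, mul_comm (2 * ε)]
      _ ≤ ε + 2 * ε * l.real univ := by gcongr

/-- Bounded measurable functions are almost everywhere limits of test functions that satisfy the
same bound. -/
theorem exists_testFunction_tendsto_ae (l : Measure O) [IsFiniteMeasure l] {g : O → ℝ}
    (hg : Measurable g) {c : ℝ} (hc : 0 < c) (hgc : ∀ x, |g x| ≤ c) :
    ∃ ξ : ℕ → 𝓓^{1}(O, ℝ), (∀ n x, |ξ n x| ≤ c) ∧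
      ∀ᵐ x : O ∂l, Tendsto (fun n => ξ n x) atTop (𝓝 (g x)) := by
  have hε : ∀ n : ℕ, (0 : ℝ) < 1 / ((n : ℝ) + 1) := fun n => Nat.one_div_pos_of_nat
  choose ξ hξc hξ using fun n : ℕ => exists_testFunction_integral_sub_le l hg hc hgc (hε n)
  have hmeas : ∀ n, Measurable fun x : O => ξ n x := fun n =>
    (ξ n).continuous.measurable.comp measurable_subtype_coe
  have hint : ∀ n, Integrable (fun x : O => ξ n x - g x) l := fun n =>
    Integrable.of_bound ((hmeas n).sub hg).aestronglyMeasurable (c + c)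
      (Eventually.of_forall fun x => (norm_sub_le _ _).trans (add_le_add (hξc n x) (hgc x)))
  have hlim : Tendsto (fun n : ℕ => eLpNorm (fun x : O => ξ n x - g x) 1 l) atTop (𝓝 0) := by
    have h1 : Tendsto (fun n : ℕ => ENNReal.ofReal (1 / ((n : ℝ) + 1) +
        2 * (1 / ((n : ℝ) + 1)) * l.real univ)) atTop (𝓝 0) := by
      have h0 := tendsto_one_div_add_atTop_nhds_zero_nat (𝕜 := ℝ)
      have := ENNReal.tendsto_ofReal (h0.add ((h0.const_mul 2).mul_const (l.real univ)))
      simpa using this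
    refine tendsto_of_tendsto_of_tendsto_of_le_of_le tendsto_const_nhds h1 (fun _ => zero_le)
      fun n => ?_
    change eLpNorm _ 1 l ≤ _
    rw [eLpNorm_one_eq_lintegral_enorm, ← ofReal_integral_norm_eq_lintegral_enorm (hint n)]
    exact ENNReal.ofReal_le_ofReal (hξ n)
  obtain ⟨ns, -, hns⟩ := (tendstoInMeasure_of_tendsto_eLpNorm one_ne_zero
    (fun n => (hmeas n).aestronglyMeasurable) hg.aestronglyMeasurable hlim).exists_seq_tendsto_ae
  exact ⟨fun n => ξ (ns n), fun n => hξc _, hns⟩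

end Approximation

/-! ### Densities of signed measures -/

section Densities

variable {X : Type*} [MeasurableSpace X]

theorem integral_toSignedMeasure_sub (a b : Measure X) [IsFiniteMeasure a] [IsFiniteMeasure b]
    {f : X → ℝ} (hf : Measurable f) {c : ℝ} (hc : ∀ x, |f x| ≤ c) :
    ∫ᵛ x, f x ∂<•(a.toSignedMeasure - b.toSignedMeasure) = ∫ x, f x ∂a - ∫ x, f x ∂b := by
  have hi : ∀ (m : Measure X) [IsFiniteMeasure m], m.toSignedMeasure.Integrable f := by
    intro m _
    rw [VectorMeasure.Integrable, Measure.variation_toSignedMeasure]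
    exact Integrable.of_bound hf.aestronglyMeasurable c (Eventually.of_forall hc)
  rw [VectorMeasure.integral_sub_vectorMeasure (hi a) (hi b),
    VectorMeasure.integral_toSignedMeasure, VectorMeasure.integral_toSignedMeasure]

/-- With respect to the finite measure `l`, the signed measure `μ` has density `h` and the measure
`m` has density `k`. -/
structure HasDensities (μ : SignedMeasure X) (m l : Measure X) (h k : X → ℝ) : Prop where
  isFiniteMeasure : IsFiniteMeasure l
  measurable_left : Measurable h
  measurable_right : Measurable k
  integrable : Integrable h l
  nonneg : ∀ x, 0 ≤ k x
  withDensity_eq : l.withDensity (fun x => ENNReal.ofReal (k x)) = m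
  integral_eq : ∀ f : X → ℝ, Measurable f → ∀ c : ℝ, (∀ x, |f x| ≤ c) →
    ∫ᵛ x, f x ∂<•μ = ∫ x, f x * h x ∂l

theorem exists_hasDensities (μ : SignedMeasure X) (m : Measure X) [IsFiniteMeasure m] :
    ∃ l h k, HasDensities μ m l h k := by
  set a := μ.toJordanDecomposition.posPart
  set b := μ.toJordanDecomposition.negPart
  have hab : a.toSignedMeasure - b.toSignedMeasure = μ := μ.toSignedMeasure_toJordanDecomposition
  -- The sum dominates both Jordan parts of `μ` and `m`, so all three have Radon–Nikodym densities.
  set l := a + b + m with hl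
  have ha : a ≪ l := Measure.absolutelyContinuous_of_le
    ((Measure.le_add_right le_rfl).trans (Measure.le_add_right le_rfl))
  have hb : b ≪ l := Measure.absolutelyContinuous_of_le
    ((Measure.le_add_left le_rfl).trans (Measure.le_add_right le_rfl))
  have hm : m ≪ l := Measure.absolutelyContinuous_of_le (Measure.le_add_left le_rfl)
  refine ⟨l, fun x => (a.rnDeriv l x).toReal - (b.rnDeriv l x).toReal,
    fun x => (m.rnDeriv l x).toReal, inferInstance, ?_, ?_, ?_, fun x => ENNReal.toReal_nonneg,
    ?_, ?_⟩
  · exact (Measure.measurable_rnDeriv a l).ennreal_toReal.sub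
      (Measure.measurable_rnDeriv b l).ennreal_toReal
  · exact (Measure.measurable_rnDeriv m l).ennreal_toReal
  · exact Measure.integrable_toReal_rnDeriv.sub Measure.integrable_toReal_rnDeriv
  · conv_rhs => rw [← Measure.withDensity_rnDeriv_eq m l hm]
    refine withDensity_congr_ae ?_
    filter_upwards [Measure.rnDeriv_lt_top m l] with x hx
    rw [ENNReal.ofReal_toReal hx.ne]
  · intro f hf c hc
    rw [← hab, integral_toSignedMeasure_sub a b hf hc, ← integral_rnDeriv_smul ha,
      ← integral_rnDeriv_smul hb, ← integral_sub]
    · refine integral_congr_ae (Eventually.of_forall fun x => ?_)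
      simp only [smul_eq_mul]
      ring
    · exact Measure.integrable_toReal_rnDeriv.mul_bdd (c := c) hf.aestronglyMeasurable
        (Eventually.of_forall hc)
    · exact Measure.integrable_toReal_rnDeriv.mul_bdd (c := c) hf.aestronglyMeasurable
        (Eventually.of_forall hc)

theorem integral_withDensity_ofReal_sub {l : Measure X} {h : X → ℝ} (hm : Measurable h)
    (hi : Integrable h l) {f : X → ℝ} (hf : Measurable f) {c : ℝ} (hc : ∀ x, |f x| ≤ c) :
    ∫ x, f x ∂(l.withDensity fun x => ENNReal.ofReal (h x)) -
      ∫ x, f x ∂(l.withDensity fun x => ENNReal.ofReal (-h x)) = ∫ x, f x * h x ∂l := by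
  rw [integral_withDensity_eq_integral_toReal_smul (by fun_prop) (by simp),
    integral_withDensity_eq_integral_toReal_smul (by fun_prop) (by simp), ← integral_sub]
  · refine integral_congr_ae (Eventually.of_forall fun x => ?_)
    simp only [smul_eq_mul]
    rcases le_total 0 (h x) with h0 | h0
    · rw [ENNReal.toReal_ofReal h0, ENNReal.ofReal_of_nonpos (by linarith)]
      simp [mul_comm]
    · rw [ENNReal.toReal_ofReal (neg_nonneg.2 h0), ENNReal.ofReal_of_nonpos h0]
      simp [mul_comm]
  · simp only [ENNReal.toReal_ofReal', smul_eq_mul]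
    exact hi.pos_part.mul_bdd (c := c) hf.aestronglyMeasurable (Eventually.of_forall hc)
  · simp only [ENNReal.toReal_ofReal', smul_eq_mul]
    exact hi.neg_part.mul_bdd (c := c) hf.aestronglyMeasurable (Eventually.of_forall hc)

theorem exists_hasDensities_self (m : Measure X) [IsFiniteMeasure m] {h : X → ℝ}
    (hm : Measurable h) (hi : Integrable h m) :
    ∃ μ : SignedMeasure X, HasDensities μ m m h fun _ => 1 := by
  have h1 : IsFiniteMeasure (m.withDensity fun x => ENNReal.ofReal (h x)) :=
    isFiniteMeasure_withDensity_ofReal hi.2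
  have h2 : IsFiniteMeasure (m.withDensity fun x => ENNReal.ofReal (-h x)) :=
    isFiniteMeasure_withDensity_ofReal hi.neg.2
  refine ⟨(m.withDensity fun x => ENNReal.ofReal (h x)).toSignedMeasure -
    (m.withDensity fun x => ENNReal.ofReal (-h x)).toSignedMeasure, inferInstance, hm,
    measurable_const, hi, fun _ => zero_le_one, ?_, fun f hf c hc => ?_⟩
  · simp
  · rw [integral_toSignedMeasure_sub _ _ hf hc, integral_withDensity_ofReal_sub hm hi hf hc]

namespace HasDensities

variable {μ : SignedMeasure X} {m l : Measure X} {h k : X → ℝ}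

theorem lintegral_eq (H : HasDensities μ m l h k) {f : X → ℝ≥0∞} (hf : Measurable f) :
    ∫⁻ x, f x ∂m = ∫⁻ x, f x * ENNReal.ofReal (k x) ∂l := by
  have hk := H.measurable_right
  rw [← H.withDensity_eq, lintegral_withDensity_eq_lintegral_mul _ (by fun_prop) hf]
  simp [mul_comm]

theorem integrable_right [IsFiniteMeasure m] (H : HasDensities μ m l h k) : Integrable k l := by
  refine ⟨H.measurable_right.aestronglyMeasurable, ?_⟩
  rw [hasFiniteIntegral_iff_ofReal (Eventually.of_forall H.nonneg)]
  have := H.lintegral_eq (f := 1) measurable_one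
  simp only [Pi.one_apply, one_mul, lintegral_one] at this
  rw [← this]
  exact measure_lt_top _ _

/-- An `m`-null set may carry `l`-mass, but only where the density `k` vanishes. -/
theorem ae_of_ae (H : HasDensities μ m l h k) {p : X → Prop} (hp : ∀ᵐ x ∂m, p x) :
    ∀ᵐ x ∂l, k x ≠ 0 → p x := by
  have hk := H.measurable_right
  rw [← H.withDensity_eq, ae_withDensity_iff (by fun_prop)] at hp
  filter_upwards [hp] with x hx h0
  exact hx (by simpa using lt_of_le_of_ne (H.nonneg x) (Ne.symm h0))

end HasDensities

end Densities

/-! ### Limits of measures along an ultrafilter -/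

theorem CompactlySupportedContinuousMap.exists_abs_le {X : Type*} [TopologicalSpace X]
    (f : C_c(X, ℝ)) : ∃ c, 0 ≤ c ∧ ∀ x, |f x| ≤ c := by
  obtain ⟨c, hc⟩ := f.hasCompactSupport.exists_bound_of_continuous f.continuous
  exact ⟨max c 0, le_max_right _ _, fun x => (hc x).trans (le_max_left _ _)⟩

/-- Vague compactness of bounded sets of measures. Each integral stays in a compact interval, so it
converges along the ultrafilter; the limits form a positive functional, represented by
Riesz–Markov–Kakutani. Mass may be lost at infinity, which is harmless for compactly supported test
functions. -/
theorem exists_tendsto_integral_of_ultrafilter {X ι : Type*} [TopologicalSpace X] [T2Space X]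
    [LocallyCompactSpace X] [MeasurableSpace X] [BorelSpace X] (U : Ultrafilter ι)
    (a : ι → Measure X) (M : ℝ≥0) (ha : ∀ i, a i univ ≤ M) :
    ∃ ν : Measure X, IsFiniteMeasure ν ∧
      ∀ f : C_c(X, ℝ), Tendsto (fun i => ∫ x, f x ∂(a i)) U (𝓝 (∫ x, f x ∂ν)) := by
  have hfin : ∀ i, IsFiniteMeasure (a i) := fun i => ⟨(ha i).trans_lt ENNReal.coe_lt_top⟩
  have hbound : ∀ (f : C_c(X, ℝ)) (c : ℝ), 0 ≤ c → (∀ x, |f x| ≤ c) → ∀ i,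
      |∫ x, f x ∂(a i)| ≤ c * M := by
    intro f c hc hf i
    have h1 := norm_integral_le_of_norm_le_const (μ := a i) (f := f) (C := c)
      (Eventually.of_forall hf)
    refine h1.trans ?_
    gcongr
    exact ENNReal.toReal_le_coe_of_le_coe (ha i)
  have hint : ∀ (f : C_c(X, ℝ)) i, Integrable f (a i) := fun f i =>
    f.continuous.integrable_of_hasCompactSupport f.hasCompactSupport
  have hlim : ∀ f : C_c(X, ℝ), ∃ y, Tendsto (fun i => ∫ x, f x ∂(a i)) U (𝓝 y) := by
    intro f
    obtain ⟨c, hc0, hc⟩ := f.exists_abs_le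
    have hmem : ∀ i, ∫ x, f x ∂(a i) ∈ Icc (-(c * M)) (c * M) := fun i =>
      abs_le.1 (hbound f c hc0 hc i)
    obtain ⟨y, -, hy⟩ := (isCompact_Icc (a := -(c * (M : ℝ))) (b := c * M)).ultrafilter_le_nhds
      (U.map fun i => ∫ x, f x ∂(a i))
      (le_principal_iff.2 (Filter.mem_map.2 (Eventually.of_forall hmem)))
    exact ⟨y, hy⟩
  choose Λ hΛ using hlim
  let L : C_c(X, ℝ) →ₚ[ℝ] ℝ := PositiveLinearMap.mk₀
    { toFun := Λ
      map_add' := fun f g => tendsto_nhds_unique (hΛ (f + g)) <| by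
        refine ((hΛ f).add (hΛ g)).congr fun i => ?_
        rw [← integral_add (hint f i) (hint g i)]
        rfl
      map_smul' := fun r f => tendsto_nhds_unique (hΛ (r • f)) <| by
        refine ((hΛ f).const_mul r).congr fun i => ?_
        rw [← integral_const_mul]
        rfl }
    fun f hf => ge_of_tendsto (hΛ f) (Eventually.of_forall fun i => integral_nonneg hf)
  refine ⟨RealRMK.rieszMeasure L, ⟨?_⟩, fun f => ?_⟩
  · refine lt_of_le_of_lt ?_ (ENNReal.coe_lt_top (r := M))
    -- By inner regularity only compact sets need a bound, and a cutoff equal to `1` on `K` has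
    -- limit integral at most `M`.
    rw [isOpen_univ.measure_eq_iSup_isCompact]
    refine iSup₂_le fun K _ => iSup_le fun hK => ?_
    obtain ⟨f, hf1, hf2, -, hf⟩ := exists_continuousMap_one_of_isCompact_subset_isOpen hK
      isOpen_univ (subset_univ K)
    let f' : C_c(X, ℝ) := ⟨f, hf2⟩
    have h1 : RealRMK.rieszMeasure L K ≤ ENNReal.ofReal (Λ f') :=
      RealRMK.rieszMeasure_le_of_eq_one L (f := f') (fun x => (hf x).1) hK hf1
    refine h1.trans (ENNReal.ofReal_le_of_le_toReal ?_)
    refine le_of_tendsto (hΛ f') (Eventually.of_forall fun i => ?_)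
    have h2 := hbound f' 1 zero_le_one
      (fun x => abs_le.2 ⟨neg_one_lt_zero.le.trans (hf x).1, (hf x).2⟩) i
    rw [one_mul] at h2
    exact (le_abs_self _).trans h2
  · rw [RealRMK.integral_rieszMeasure]
    exact hΛ f

/-! ### Convex functions of measures -/

section ConvexFunction

variable {d : ℕ} {O : Opens (Rd d)} {ψ : ℝ → ℝ} {R : ℝ}

instance : (vol O).IsOpenPosMeasure :=
  Measure.IsOpenPosMeasure.comap volume O.isOpen.isOpenEmbedding_subtypeVal

theorem isFiniteMeasure_vol (hO : Bornology.IsBounded (O : Set (Rd d))) :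
    IsFiniteMeasure (vol O) := by
  refine ⟨?_⟩
  have h := (measurePreserving_subtype_coe (μa := (volume : Measure (Rd d)))
    O.isOpen.measurableSet).measure_preimage MeasurableSet.univ.nullMeasurableSet
  rw [preimage_univ, Measure.restrict_apply_univ] at h
  exact h.trans_lt hO.measure_lt_top

/-- Integrability of `ψ*(v)` gives the bound almost everywhere; by continuity of `v` the exceptional
set is open, and an open null set is empty. The bound must hold everywhere because `μ` may charge
Lebesgue-null sets. -/
theorem abs_le_of_mem_conjugateDomain (hψ : IsPotential ψ) (hR : IsRecessionSlope ψ R)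
    {v : C_c(O, ℝ)} (hv : v ∈ conjugateDomain O ψ) (x : O) : |v x| ≤ R := by
  have h1 : ∀ᵐ x ∂(vol O), convexConjugate ψ (v x) < ∞ :=
    ae_lt_top ((measurable_convexConjugate ψ).comp v.continuous.measurable) (ne_of_lt hv)
  have hopen : IsOpen {x : O | R < |v x|} := isOpen_lt continuous_const v.continuous.abs
  have h0 : vol O {x : O | R < |v x|} = 0 := by
    refine measure_mono_null (fun x hx => ?_) (ae_iff.1 h1)
    intro hlt
    exact absurd (hR.abs_le hψ hlt.ne) (not_le.2 hx)
  have hempty := hopen.eq_empty_of_measure_zero h0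
  by_contra! hlt
  exact (hempty.subset hlt : x ∈ (∅ : Set O))

/-! ### The duality formula in terms of densities -/

section Densities

variable {μ : SignedMeasure O} {l : Measure O} {h k : O → ℝ}

theorem HasDensities.lintegral_convexConjugate_mul (H : HasDensities μ (vol O) l h k) {v η : O → ℝ}
    (hv : Measurable v) (hη : Measurable η) (hη0 : ∀ x, 0 ≤ η x) {B : ℝ} (hηB : ∀ x, η x ≤ B)
    (hfin : ∫⁻ x, convexConjugate ψ (v x) ∂(vol O) < ∞) :
    Integrable (fun x => (convexConjugate ψ (v x)).toReal * k x * η x) l ∧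
      (∫⁻ x, convexConjugate ψ (v x) * ENNReal.ofReal (η x) ∂(vol O)).toReal =
        ∫ x, (convexConjugate ψ (v x)).toReal * k x * η x ∂l := by
  have := H.isFiniteMeasure
  have hk := H.measurable_right
  have hmeas : Measurable fun x => convexConjugate ψ (v x) :=
    (measurable_convexConjugate ψ).comp hv
  have hae := H.ae_of_ae (ae_lt_top hmeas hfin.ne)
  have heq : ∀ᵐ x ∂l, convexConjugate ψ (v x) * ENNReal.ofReal (η x) * ENNReal.ofReal (k x) =
      ENNReal.ofReal ((convexConjugate ψ (v x)).toReal * k x * η x) := by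
    filter_upwards [hae] with x hx
    rcases eq_or_ne (k x) 0 with h0 | h0
    · simp [h0]
    · rw [ENNReal.ofReal_mul (mul_nonneg ENNReal.toReal_nonneg (H.nonneg x)),
        ENNReal.ofReal_mul ENNReal.toReal_nonneg, ENNReal.ofReal_toReal (hx h0).ne]
      ring
  have hnn : ∀ x, 0 ≤ (convexConjugate ψ (v x)).toReal * k x * η x := fun x =>
    mul_nonneg (mul_nonneg ENNReal.toReal_nonneg (H.nonneg x)) (hη0 x)
  have hlin : ∫⁻ x, convexConjugate ψ (v x) * ENNReal.ofReal (η x) ∂(vol O) =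
      ∫⁻ x, ENNReal.ofReal ((convexConjugate ψ (v x)).toReal * k x * η x) ∂l := by
    rw [H.lintegral_eq (by fun_prop)]
    exact lintegral_congr_ae heq
  have hm : Measurable fun x => (convexConjugate ψ (v x)).toReal * k x * η x := by fun_prop
  constructor
  · refine ⟨hm.aestronglyMeasurable, ?_⟩
    rw [hasFiniteIntegral_iff_ofReal (Eventually.of_forall hnn), ← hlin]
    calc ∫⁻ x, convexConjugate ψ (v x) * ENNReal.ofReal (η x) ∂(vol O)
        ≤ ∫⁻ x, convexConjugate ψ (v x) * ENNReal.ofReal B ∂(vol O) := by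
          gcongr with x
          exact hηB x
      _ = (∫⁻ x, convexConjugate ψ (v x) ∂(vol O)) * ENNReal.ofReal B :=
          lintegral_mul_const _ hmeas
      _ < ∞ := ENNReal.mul_lt_top hfin ENNReal.ofReal_lt_top
  · rw [integral_eq_lintegral_of_nonneg_ae (Eventually.of_forall hnn) hm.aestronglyMeasurable,
      hlin]

theorem HasDensities.integral_sub_lintegral_convexConjugate (H : HasDensities μ (vol O) l h k)
    {v η : O → ℝ} (hv : Measurable v) {c : ℝ} (hc : ∀ x, |v x| ≤ c) (hη : Measurable η)
    (hη0 : ∀ x, 0 ≤ η x) {B : ℝ} (hηB : ∀ x, η x ≤ B)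
    (hfin : ∫⁻ x, convexConjugate ψ (v x) ∂(vol O) < ∞) :
    Integrable (fun x => (v x * h x - (convexConjugate ψ (v x)).toReal * k x) * η x) l ∧
      (∫ᵛ x : O, v x * η x ∂<•μ) -
        (∫⁻ x, convexConjugate ψ (v x) * ENNReal.ofReal (η x) ∂(vol O)).toReal =
        ∫ x, (v x * h x - (convexConjugate ψ (v x)).toReal * k x) * η x ∂l := by
  have := H.isFiniteMeasure
  obtain ⟨hi, he⟩ := H.lintegral_convexConjugate_mul hv hη hη0 hηB hfin
  have hvη : ∀ x, |v x * η x| ≤ c * B := by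
    intro x
    rw [abs_mul, abs_of_nonneg (hη0 x)]
    exact mul_le_mul (hc x) (hηB x) (hη0 x) ((abs_nonneg _).trans (hc x))
  have hi' : Integrable (fun x => v x * η x * h x) l := by
    refine (H.integrable.bdd_mul (c := c * B) (hv.mul hη).aestronglyMeasurable
      (Eventually.of_forall hvη))
  have hfun : (fun x => (v x * h x - (convexConjugate ψ (v x)).toReal * k x) * η x) =
      fun x => v x * η x * h x - (convexConjugate ψ (v x)).toReal * k x * η x := by
    ext x; ring
  rw [hfun]
  refine ⟨hi'.sub hi, ?_⟩
  rw [integral_sub hi' hi, he, H.integral_eq (fun x => v x * η x) (hv.mul hη) _ hvη]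

theorem HasDensities.integrable_perspective (H : HasDensities μ (vol O) l h k)
    (hψ : IsPotential ψ) (hR : IsRecessionSlope ψ R) :
    Integrable (fun x => perspective ψ R (h x) (k x)) l := by
  refine (H.integrable.abs.const_mul R).mono'
    (measurable_perspective hψ R H.measurable_left H.measurable_right).aestronglyMeasurable
    (Eventually.of_forall fun x => ?_)
  rw [Real.norm_of_nonneg (perspective_nonneg hψ hR (H.nonneg x))]
  exact perspective_le hR (H.nonneg x)

theorem HasDensities.integral_sub_le (H : HasDensities μ (vol O) l h k)
    (hψ : IsPotential ψ) (hR : IsRecessionSlope ψ R) {v : C_c(O, ℝ)}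
    (hv : v ∈ conjugateDomain O ψ) {η : O → ℝ} (hη : Measurable η)
    (hη0 : ∀ x, 0 ≤ η x) {B : ℝ} (hηB : ∀ x, η x ≤ B) :
    (∫ᵛ x : O, v x * η x ∂<•μ) -
        (∫⁻ x, convexConjugate ψ (v x) * ENNReal.ofReal (η x) ∂(vol O)).toReal ≤
      ∫ x, perspective ψ R (h x) (k x) * η x ∂l := by
  have hvR := abs_le_of_mem_conjugateDomain hψ hR hv
  have hvm : Measurable v := v.continuous.measurable
  obtain ⟨hi, he⟩ := H.integral_sub_lintegral_convexConjugate hvm hvR hη hη0 hηB hv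
  have hae := H.ae_of_ae (ae_lt_top ((measurable_convexConjugate ψ).comp hvm) (ne_of_lt hv))
  rw [he]
  refine integral_mono_ae hi ((H.integrable_perspective hψ hR).mul_bdd (c := B)
    hη.aestronglyMeasurable (Eventually.of_forall fun x => ?_)) ?_
  · rw [Real.norm_of_nonneg (hη0 x)]
    exact hηB x
  · filter_upwards [hae] with x hx
    exact mul_le_mul_of_nonneg_right (mul_sub_convexConjugate_mul_le_perspective (hvR x)
      (fun h0 => (hx h0).ne) (H.nonneg x)) (hη0 x)

/-- The hard half of the duality: the pointwise near-maximizer `g = θ * perspectiveSlope` is merely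
measurable, and is replaced by test functions `ξ n → g` bounded by `θ R < R`. This bound puts every
`ξ n` in the conjugate domain and supplies the dominating function. -/
theorem HasDensities.exists_lt_integral_sub [IsFiniteMeasure (vol O)]
    (H : HasDensities μ (vol O) l h k)
    (hψ : IsPotential ψ) (hR : IsRecessionSlope ψ R) {η : O → ℝ} (hη : Measurable η)
    (hη0 : ∀ x, 0 ≤ η x) {B : ℝ} (hηB : ∀ x, η x ≤ B) {T : ℝ}
    (hT : T < ∫ x, perspective ψ R (h x) (k x) * η x ∂l) :
    ∃ ξ : 𝓓^{1}(O, ℝ), testFunctionRestrict ξ ∈ conjugateDomain O ψ ∧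
      T < (∫ᵛ x : O, ξ x * η x ∂<•μ) -
        (∫⁻ x : O, convexConjugate ψ (ξ x) * ENNReal.ofReal (η x) ∂(vol O)).toReal := by
  have := H.isFiniteMeasure
  have hRpos := hR.pos
  set I := ∫ x, perspective ψ R (h x) (k x) * η x ∂l
  -- The strict inequality `T < I` leaves room to shrink the maximizer away from `±R`, where `ψ*`
  -- may be infinite or discontinuous.
  obtain ⟨θ, ⟨hθ0, hθ1⟩, hθT⟩ : ∃ θ : ℝ, (0 < θ ∧ θ < 1) ∧ T < θ * I := by
    have h1 : ∀ᶠ θ : ℝ in 𝓝[<] 1, T < θ * I := by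
      have : Tendsto (fun θ : ℝ => θ * I) (𝓝[<] 1) (𝓝 (1 * I)) :=
        ((continuous_id.mul continuous_const).tendsto 1).mono_left nhdsWithin_le_nhds
      exact this.eventually (lt_mem_nhds (by rwa [one_mul]))
    have h2 : ∀ᶠ θ : ℝ in 𝓝[<] 1, θ ∈ Ioo 0 1 := Ioo_mem_nhdsLT zero_lt_one
    exact (h2.and h1).exists
  set g : O → ℝ := fun x => θ * perspectiveSlope ψ R (h x) (k x)
  have hg : Measurable g :=
    (measurable_perspectiveSlope hψ R H.measurable_left H.measurable_right).const_mul θ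
  have hgc : ∀ x, |g x| ≤ θ * R := by
    intro x
    rw [abs_mul, abs_of_pos hθ0]
    exact mul_le_mul_of_nonneg_left (abs_perspectiveSlope_le hψ hR _ _) hθ0.le
  have hcR : θ * R < R := by nlinarith
  have hc0 : 0 < θ * R := by positivity
  obtain ⟨ξ, hξc, hξ⟩ := exists_testFunction_tendsto_ae l hg hc0 hgc
  set S := convexConjugate ψ (θ * R)
  have hS : S ≠ ∞ := hR.convexConjugate_ne_top hψ (by rwa [abs_of_pos hc0])
  have hconj : ∀ n x, convexConjugate ψ (ξ n x) ≤ S := fun n x =>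
    hψ.convexConjugate_mono (by rw [abs_of_pos hc0]; exact hξc n x)
  have hdom : ∀ n, testFunctionRestrict (ξ n) ∈ conjugateDomain O ψ := by
    intro n
    refine lt_of_le_of_lt (lintegral_mono (μ := vol O) (g := fun _ => S) fun x => hconj n x) ?_
    rw [lintegral_const]
    exact ENNReal.mul_lt_top hS.lt_top (measure_lt_top _ _)
  have hξm : ∀ n, Measurable fun x : O => ξ n x := fun n =>
    (ξ n).continuous.measurable.comp measurable_subtype_coe
  have hval := fun n => H.integral_sub_lintegral_convexConjugate (hξm n) (fun x => hξc n x)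
    hη hη0 hηB (hdom n)
  have hlim : Tendsto (fun n => ∫ x : O,
      (ξ n x * h x - (convexConjugate ψ (ξ n x)).toReal * k x) * η x ∂l) atTop
      (𝓝 (∫ x, (g x * h x - (convexConjugate ψ (g x)).toReal * k x) * η x ∂l)) := by
    refine tendsto_integral_of_dominated_convergence
      (fun x => (θ * R * |h x| + S.toReal * k x) * B) (fun n => (hval n).1.aestronglyMeasurable)
      (((H.integrable.abs.const_mul _).add (H.integrable_right.const_mul _)).mul_const _)
      (fun n => Eventually.of_forall fun x => ?_) ?_
    · rw [norm_mul, Real.norm_of_nonneg (hη0 x)]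
      have hk := H.nonneg x
      refine mul_le_mul ((norm_sub_le _ _).trans (add_le_add ?_ ?_)) (hηB x) (hη0 x) ?_
      · rw [norm_mul]
        exact mul_le_mul_of_nonneg_right (hξc n x) (norm_nonneg _)
      · rw [norm_mul, Real.norm_of_nonneg hk, Real.norm_of_nonneg ENNReal.toReal_nonneg]
        exact mul_le_mul_of_nonneg_right (ENNReal.toReal_mono hS (hconj n x)) hk
      · positivity
    · filter_upwards [hξ] with x hx
      have hcont : ContinuousAt (fun s => (convexConjugate ψ s).toReal) (g x) :=
        (hR.continuousOn_toReal_convexConjugate hψ).continuousAt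
          (isOpen_Ioo.mem_nhds (abs_lt.1 ((hgc x).trans_lt hcR)))
      exact ((hx.mul_const _).sub ((hcont.tendsto.comp hx).mul_const _)).mul_const _
  have hle : θ * I ≤ ∫ x, (g x * h x - (convexConjugate ψ (g x)).toReal * k x) * η x ∂l := by
    have hgfin : ∫⁻ x, convexConjugate ψ (g x) ∂(vol O) < ∞ := by
      refine lt_of_le_of_lt (lintegral_mono (g := fun _ => S) fun x =>
        hψ.convexConjugate_mono (by rw [abs_of_pos hc0]; exact hgc x)) ?_
      rw [lintegral_const]
      exact ENNReal.mul_lt_top hS.lt_top (measure_lt_top _ _)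
    rw [← integral_const_mul]
    refine integral_mono (((H.integrable_perspective hψ hR).mul_bdd (c := B)
      hη.aestronglyMeasurable (Eventually.of_forall fun x => ?_)).const_mul _)
      (H.integral_sub_lintegral_convexConjugate hg hgc hη hη0 hηB hgfin).1 fun x => ?_
    · rw [Real.norm_of_nonneg (hη0 x)]
      exact hηB x
    · have := mul_le_mul_of_nonneg_right
        (mul_perspective_le (R := R) hψ (h := h x) (H.nonneg x) hθ0.le hθ1.le) (hη0 x)
      rwa [mul_assoc] at this
  obtain ⟨n, hn⟩ := (hlim.eventually (lt_mem_nhds (hθT.trans_le hle))).exists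
  exact ⟨ξ n, hdom n, by rwa [(hval n).2]⟩

theorem HasDensities.isConvexFunctionOfMeasure [IsFiniteMeasure (vol O)]
    (H : HasDensities μ (vol O) l h k) (hψ : IsPotential ψ) (hR : IsRecessionSlope ψ R) :
    IsConvexFunctionOfMeasure ψ μ
      (l.withDensity fun x => ENNReal.ofReal (perspective ψ R (h x) (k x))) := by
  have hP := measurable_perspective hψ R H.measurable_left H.measurable_right
  refine ⟨isFiniteMeasure_withDensity_ofReal (H.integrable_perspective hψ hR).2,
    fun η hη0 => ?_⟩
  have hηm : Measurable η := η.continuous.measurable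
  obtain ⟨B, hB⟩ : ∃ B, ∀ x, η x ≤ B :=
    ⟨‖η.toBCF‖, fun x => (le_abs_self _).trans (η.toBCF.norm_coe_le_norm x)⟩
  have hint : ∫ x, η x ∂(l.withDensity fun x => ENNReal.ofReal (perspective ψ R (h x) (k x))) =
      ∫ x, perspective ψ R (h x) (k x) * η x ∂l := by
    rw [integral_withDensity_eq_integral_toReal_smul (by fun_prop) (by simp)]
    refine integral_congr_ae (Eventually.of_forall fun x => ?_)
    simp only [smul_eq_mul]
    rw [ENNReal.toReal_ofReal (perspective_nonneg hψ hR (H.nonneg x))]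
  rw [hint]
  constructor
  · rintro _ ⟨v, hv, rfl⟩
    exact H.integral_sub_le hψ hR hv hηm hη0 hB
  · intro b hb
    refine le_of_forall_lt fun T hT => ?_
    obtain ⟨ξ, hξ, hlt⟩ := H.exists_lt_integral_sub hψ hR hηm hη0 hB hT
    exact hlt.trans_le (hb ⟨_, hξ, rfl⟩)

end Densities

/-- Nonnegative compactly supported functions lie in `C₀(O)` and determine a finite measure. -/
theorem IsConvexFunctionOfMeasure.unique {μ : SignedMeasure O} {ν ν' : Measure O}
    (h : IsConvexFunctionOfMeasure ψ μ ν) (h' : IsConvexFunctionOfMeasure ψ μ ν') : ν = ν' := by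
  have := h.1
  have := h'.1
  refine Measure.ext_of_integral_eq_on_compactlySupported_nnreal fun f => ?_
  let η : C₀(O, ℝ) :=
    { toFun := fun x => f x
      continuous_toFun := by fun_prop
      zero_at_infty' := by
        have : HasCompactSupport fun x => (f x : ℝ) :=
          f.hasCompactSupport.comp_left (g := fun y : ℝ≥0 => (y : ℝ)) rfl
        exact this.is_zero_at_infty }
  exact (h.2 η fun x => (f x).2).unique (h'.2 η fun x => (f x).2)

theorem existsUnique_isConvexFunctionOfMeasure [IsFiniteMeasure (vol O)] (hψ : IsPotential ψ)
    (hR : IsRecessionSlope ψ R) (μ : SignedMeasure O) :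
    ∃! ν : Measure O, IsConvexFunctionOfMeasure ψ μ ν := by
  obtain ⟨l, h, k, H⟩ := exists_hasDensities μ (vol O)
  exact ⟨_, H.isConvexFunctionOfMeasure hψ hR,
    fun _ hν => hν.unique (H.isConvexFunctionOfMeasure hψ hR)⟩

theorem HasDensities.convexFunctionOfMeasure_univ [IsFiniteMeasure (vol O)]
    {μ : SignedMeasure O} {l : Measure O} {h k : O → ℝ} (H : HasDensities μ (vol O) l h k)
    (hψ : IsPotential ψ) (hR : IsRecessionSlope ψ R) :
    convexFunctionOfMeasure ψ μ univ =
      ∫⁻ x, ENNReal.ofReal (perspective ψ R (h x) (k x)) ∂l := by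
  have hν := H.isConvexFunctionOfMeasure hψ hR
  have hex : ∃ ν : Measure O, IsConvexFunctionOfMeasure ψ μ ν := ⟨_, hν⟩
  rw [convexFunctionOfMeasure, dif_pos hex, hex.choose_spec.unique hν,
    withDensity_apply _ MeasurableSet.univ, Measure.restrict_univ]

end ConvexFunction

/-! ### The dual formula for the energy -/

section Energy

variable {d : ℕ} {O : Opens (Rd d)} {ψ : ℝ → ℝ} {R : ℝ}

/-- The functional `u ↦ sup {u(ξ) - ∫ ψ*(ξ) dx : ξ ∈ C¹_c(O), ψ*(ξ) ∈ L¹(O)}` on `H⁻¹(O)`. -/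
noncomputable def dualEnergy (ψ : ℝ → ℝ) (u : HNegOne O) : ℝ≥0∞ :=
  ⨆ ξ : {ξ : 𝓓^{1}(O, ℝ) // testFunctionRestrict ξ ∈ conjugateDomain O ψ},
    ENNReal.ofReal (u (H10.ofTest O ξ.1) -
      (∫⁻ x : O, convexConjugate ψ (ξ.1 x) ∂(vol O)).toReal)

theorem lowerSemicontinuous_dualEnergy (ψ : ℝ → ℝ) :
    LowerSemicontinuous (dualEnergy ψ : HNegOne O → ℝ≥0∞) := by
  refine lowerSemicontinuous_iSup fun ξ => ?_
  have h : Continuous fun u : HNegOne O => u (H10.ofTest O ξ.1) :=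
    (ContinuousLinearMap.apply ℝ ℝ (H10.ofTest O ξ.1)).continuous
  exact (ENNReal.continuous_ofReal.comp (h.sub continuous_const)).lowerSemicontinuous

theorem dualEnergy_smul_add_smul_le (ψ : ℝ → ℝ) (u w : HNegOne O) {a b : ℝ≥0} (hab : a + b = 1) :
    dualEnergy ψ (a • u + b • w) ≤ a • dualEnergy ψ u + b • dualEnergy ψ w := by
  refine iSup_le fun ξ => ?_
  set c := (∫⁻ x : O, convexConjugate ψ (ξ.1 x) ∂(vol O)).toReal
  have hab' : (a : ℝ) + b = 1 := by exact_mod_cast hab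
  have key : (a • u + b • w) (H10.ofTest O ξ.1) - c =
      a * (u (H10.ofTest O ξ.1) - c) + b * (w (H10.ofTest O ξ.1) - c) := by
    change (a : ℝ) * u (H10.ofTest O ξ.1) + b * w (H10.ofTest O ξ.1) - c = _
    linear_combination c * hab'
  rw [key]
  refine ENNReal.ofReal_add_le.trans ?_
  rw [ENNReal.ofReal_mul a.coe_nonneg, ENNReal.ofReal_mul b.coe_nonneg, ENNReal.ofReal_coe_nnreal,
    ENNReal.ofReal_coe_nnreal, ENNReal.smul_def, ENNReal.smul_def, smul_eq_mul, smul_eq_mul]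
  gcongr
  · exact le_iSup (fun ξ : {ξ : 𝓓^{1}(O, ℝ) // testFunctionRestrict ξ ∈ conjugateDomain O ψ} =>
      ENNReal.ofReal (u (H10.ofTest O ξ.1) -
        (∫⁻ x : O, convexConjugate ψ (ξ.1 x) ∂(vol O)).toReal)) ξ
  · exact le_iSup (fun ξ : {ξ : 𝓓^{1}(O, ℝ) // testFunctionRestrict ξ ∈ conjugateDomain O ψ} =>
      ENNReal.ofReal (w (H10.ofTest O ξ.1) -
        (∫⁻ x : O, convexConjugate ψ (ξ.1 x) ∂(vol O)).toReal)) ξ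

variable [IsFiniteMeasure (vol O)]

/-- Both halves of the duality with weight `η = 1`. This weight need not be in `C₀(O)`, which is why
those bounds are proved for bounded measurable `η`. -/
theorem HasDensities.dualEnergy_eq {μ : SignedMeasure O} {l : Measure O} {h k : O → ℝ}
    (H : HasDensities μ (vol O) l h k) (hψ : IsPotential ψ) (hR : IsRecessionSlope ψ R)
    {u : HNegOne O} (hu : IsGivenByMeasure u μ) :
    dualEnergy ψ u = ∫⁻ x, ENNReal.ofReal (perspective ψ R (h x) (k x)) ∂l := by
  rw [← ofReal_integral_eq_lintegral_ofReal (H.integrable_perspective hψ hR)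
    (Eventually.of_forall fun x => perspective_nonneg hψ hR (H.nonneg x))]
  apply le_antisymm
  · refine iSup_le fun ξ => ENNReal.ofReal_le_ofReal ?_
    rw [hu]
    have hle := H.integral_sub_le hψ hR ξ.2 (η := fun _ => 1) (B := 1) measurable_const
      (fun _ => zero_le_one) fun _ => le_rfl
    simp only [mul_one, ENNReal.ofReal_one] at hle
    exact hle
  · refine le_of_forall_lt fun T hT => ?_
    have hT' : T.toReal < ∫ x, perspective ψ R (h x) (k x) * 1 ∂l := by
      simpa using (ENNReal.lt_ofReal_iff_toReal_lt hT.ne_top).1 hT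
    obtain ⟨ξ, hξ, hlt⟩ := H.exists_lt_integral_sub hψ hR (η := fun _ => 1) (B := 1)
      measurable_const (fun _ => zero_le_one) (fun _ => le_rfl) hT'
    simp only [mul_one, ENNReal.ofReal_one] at hlt
    refine lt_of_lt_of_le ((ENNReal.lt_ofReal_iff_toReal_lt hT.ne_top).2 hlt) ?_
    rw [← hu]
    exact le_iSup (fun ξ : {ξ : 𝓓^{1}(O, ℝ) // testFunctionRestrict ξ ∈ conjugateDomain O ψ} =>
      ENNReal.ofReal (u (H10.ofTest O ξ.1) -
        (∫⁻ x : O, convexConjugate ψ (ξ.1 x) ∂(vol O)).toReal)) ⟨ξ, hξ⟩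

/-- The right side involves `u` only, so the energy does not depend on which representing measure is
chosen. -/
theorem energySublinear_eq_dualEnergy (hψ : IsPotential ψ) (hR : IsRecessionSlope ψ R)
    {u : HNegOne O} (hu : ∃ μ : SignedMeasure O, IsGivenByMeasure u μ) :
    energySublinear O ψ u = dualEnergy ψ u := by
  rw [energySublinear, dif_pos hu]
  obtain ⟨l, h, k, H⟩ := exists_hasDensities hu.choose (vol O)
  rw [H.convexFunctionOfMeasure_univ hψ hR, H.dualEnergy_eq hψ hR hu.choose_spec]

theorem dualEnergy_le_energySublinear (hψ : IsPotential ψ) (hR : IsRecessionSlope ψ R)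
    (u : HNegOne O) : dualEnergy ψ u ≤ energySublinear O ψ u := by
  by_cases hu : ∃ μ : SignedMeasure O, IsGivenByMeasure u μ
  · exact (energySublinear_eq_dualEnergy hψ hR hu).ge
  · rw [energySublinear, dif_neg hu]
    exact le_top

omit [IsFiniteMeasure (vol O)] in
theorem exists_isGivenByMeasure_of_energySublinear_ne_top {u : HNegOne O}
    (hu : energySublinear O ψ u ≠ ∞) : ∃ μ : SignedMeasure O, IsGivenByMeasure u μ := by
  by_contra h
  exact hu (by rw [energySublinear, dif_neg h])

omit [IsFiniteMeasure (vol O)] in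
theorem testFunction_exists_abs_le (η : 𝓓^{1}(O, ℝ)) : ∃ c, ∀ x : O, |η x| ≤ c := by
  obtain ⟨c, -, hc⟩ := (testFunctionRestrict η).exists_abs_le
  exact ⟨c, hc⟩

omit [IsFiniteMeasure (vol O)] in
theorem testFunction_measurable (η : 𝓓^{1}(O, ℝ)) : Measurable fun x : O => η x :=
  (testFunctionRestrict η).continuous.measurable

omit [IsFiniteMeasure (vol O)] in
theorem IsGivenByMeasure.smul_add_smul {u w : HNegOne O} {μ ν : SignedMeasure O}
    (hu : IsGivenByMeasure u μ) (hw : IsGivenByMeasure w ν) (a b : ℝ≥0) :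
    IsGivenByMeasure (a • u + b • w) ((a : ℝ) • μ + (b : ℝ) • ν) := by
  intro η
  obtain ⟨c, hc⟩ := testFunction_exists_abs_le η
  have hi : ∀ m : SignedMeasure O, m.Integrable fun x : O => η x := fun m => by
    have : IsFiniteMeasure m.variation := by
      rw [← SignedMeasure.totalVariation_eq_variation]
      infer_instance
    exact Integrable.of_bound (testFunction_measurable η).aestronglyMeasurable c
      (Eventually.of_forall hc)
  rw [VectorMeasure.integral_add_vectorMeasure ((hi μ).smul_vectorMeasure _)
    ((hi ν).smul_vectorMeasure _), VectorMeasure.integral_smul_vectorMeasure,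
    VectorMeasure.integral_smul_vectorMeasure, ← hu η, ← hw η]
  rfl

/-! ### Convexity and lower semicontinuity in the sublinear case -/

theorem convexOn_energySublinear (hψ : IsPotential ψ) (hR : IsRecessionSlope ψ R) :
    ConvexOn ℝ≥0 univ (energySublinear O ψ) := by
  refine ⟨convex_univ, fun u _ w _ a b _ _ hab => ?_⟩
  -- Zero weights are treated apart because `0 * ∞ = 0`; with positive weights an infinite energy
  -- makes the right side infinite.
  rcases eq_or_ne a 0 with rfl | ha
  · rw [zero_add] at hab
    simp [hab]
  rcases eq_or_ne b 0 with rfl | hb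
  · rw [add_zero] at hab
    simp [hab]
  by_cases hu : ∃ μ : SignedMeasure O, IsGivenByMeasure u μ
  · by_cases hw : ∃ μ : SignedMeasure O, IsGivenByMeasure w μ
    · rw [energySublinear_eq_dualEnergy hψ hR hu, energySublinear_eq_dualEnergy hψ hR hw]
      obtain ⟨μ, hμ⟩ := hu
      obtain ⟨ν, hν⟩ := hw
      rw [energySublinear_eq_dualEnergy hψ hR ⟨_, hμ.smul_add_smul hν a b⟩]
      exact dualEnergy_smul_add_smul_le ψ u w hab
    · have : energySublinear O ψ w = ∞ := dif_neg hw
      simp [this, ENNReal.smul_def, hb]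
  · have : energySublinear O ψ u = ∞ := dif_neg hu
    simp [this, ENNReal.smul_def, ha]

theorem exists_measures_of_energySublinear_le (hψ : IsPotential ψ) (hR : IsRecessionSlope ψ R)
    {y : ℝ≥0∞} (hy : y ≠ ∞) : ∃ M : ℝ≥0, ∀ u : HNegOne O, energySublinear O ψ u ≤ y →
      ∃ a b : Measure O, a univ ≤ M ∧ b univ ≤ M ∧
        ∀ η : 𝓓^{1}(O, ℝ), u (H10.ofTest O η) = ∫ x : O, η x ∂a - ∫ x : O, η x ∂b := by
  obtain ⟨c, B, hc, hB, hcB⟩ := exists_mul_abs_le_perspective hψ hR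
  -- Integrating `c |h| ≤ perspective + B k` against `l` bounds the variation `∫ |h| dl` by `N`.
  set N : ℝ≥0∞ := (y + ENNReal.ofReal B * vol O univ) / ENNReal.ofReal c
  have hN : N ≠ ∞ := ENNReal.div_ne_top
    (ENNReal.add_ne_top.2 ⟨hy, ENNReal.mul_ne_top ENNReal.ofReal_ne_top (measure_ne_top _ _)⟩)
    (by simpa using hc)
  refine ⟨N.toNNReal, fun u hu => ?_⟩
  rw [ENNReal.coe_toNNReal hN]
  have hex := exists_isGivenByMeasure_of_energySublinear_ne_top (ne_top_of_le_ne_top hy hu)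
  rw [energySublinear_eq_dualEnergy hψ hR hex] at hu
  obtain ⟨μ, hμ⟩ := hex
  obtain ⟨l, h, k, H⟩ := exists_hasDensities μ (vol O)
  have hm := H.measurable_left
  have hk := H.measurable_right
  rw [H.dualEnergy_eq hψ hR hμ] at hu
  have hvar : ∫⁻ x, ENNReal.ofReal |h x| ∂l ≤ N := by
    rw [ENNReal.le_div_iff_mul_le (Or.inl (by simpa using hc)) (Or.inl ENNReal.ofReal_ne_top)]
    have hvol : vol O univ = ∫⁻ x, ENNReal.ofReal (k x) ∂l := by
      have := H.lintegral_eq (f := 1) measurable_one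
      simpa using this
    calc (∫⁻ x, ENNReal.ofReal |h x| ∂l) * ENNReal.ofReal c
        = ∫⁻ x, ENNReal.ofReal (c * |h x|) ∂l := by
          rw [← lintegral_mul_const _ (by fun_prop)]
          refine lintegral_congr fun x => ?_
          rw [mul_comm c, ENNReal.ofReal_mul (abs_nonneg _)]
      _ ≤ ∫⁻ x, (ENNReal.ofReal (perspective ψ R (h x) (k x)) +
            ENNReal.ofReal B * ENNReal.ofReal (k x)) ∂l := by
          refine lintegral_mono fun x => ?_
          change _ ≤ ENNReal.ofReal _ + _
          rw [← ENNReal.ofReal_mul hB, ← ENNReal.ofReal_add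
            (perspective_nonneg hψ hR (H.nonneg x)) (mul_nonneg hB (H.nonneg x))]
          exact ENNReal.ofReal_le_ofReal (hcB _ _ (H.nonneg x))
      _ = ∫⁻ x, ENNReal.ofReal (perspective ψ R (h x) (k x)) ∂l +
            ENNReal.ofReal B * vol O univ := by
          rw [lintegral_add_right _ (by fun_prop), lintegral_const_mul _ (by fun_prop), hvol]
      _ ≤ y + ENNReal.ofReal B * vol O univ := by gcongr
  refine ⟨l.withDensity fun x => ENNReal.ofReal (h x), l.withDensity fun x => ENNReal.ofReal (-h x),
    ?_, ?_, fun η => ?_⟩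
  · rw [withDensity_apply _ MeasurableSet.univ, Measure.restrict_univ]
    exact (lintegral_mono fun x => ENNReal.ofReal_le_ofReal (le_abs_self _)).trans hvar
  · rw [withDensity_apply _ MeasurableSet.univ, Measure.restrict_univ]
    exact (lintegral_mono fun x => ENNReal.ofReal_le_ofReal (neg_le_abs _)).trans hvar
  · obtain ⟨c', hc'⟩ := testFunction_exists_abs_le η
    rw [integral_withDensity_ofReal_sub hm H.integrable (testFunction_measurable η) hc', hμ η,
      H.integral_eq _ (testFunction_measurable η) c' hc']

/-- The energy agrees with the lower semicontinuous `dualEnergy` only where a representing measure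
exists. If the claim fails at `u`, an ultrafilter in a sublevel set converges to `u`; mass bounds
and vague compactness give a measure for `u`, so the two functionals agree at `u`, a contradiction.
-/
theorem lowerSemicontinuous_energySublinear (hψ : IsPotential ψ) (hR : IsRecessionSlope ψ R) :
    LowerSemicontinuous (energySublinear O ψ) := by
  intro u y hyu
  by_contra hnot
  have hfreq : ∃ᶠ w in 𝓝 u, energySublinear O ψ w ≤ y :=
    (not_eventually.1 hnot).mono fun w hw => not_lt.1 hw
  have hne : (𝓝 u ⊓ 𝓟 {w | energySublinear O ψ w ≤ y}).NeBot :=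
    frequently_mem_iff_neBot.1 hfreq
  set U := Ultrafilter.of (𝓝 u ⊓ 𝓟 {w | energySublinear O ψ w ≤ y})
  have hU : (U : Filter (HNegOne O)) ≤ 𝓝 u ⊓ 𝓟 {w | energySublinear O ψ w ≤ y} :=
    Ultrafilter.of_le _
  have hUu : (U : Filter (HNegOne O)) ≤ 𝓝 u := hU.trans inf_le_left
  have hUy : ∀ᶠ w in U, energySublinear O ψ w ≤ y := le_principal_iff.1 (hU.trans inf_le_right)
  obtain ⟨M, hM⟩ := exists_measures_of_energySublinear_le (O := O) hψ hR hyu.ne_top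
  have hM' : ∀ w : HNegOne O, ∃ a b : Measure O, a univ ≤ M ∧ b univ ≤ M ∧
      (energySublinear O ψ w ≤ y → ∀ η : 𝓓^{1}(O, ℝ),
        w (H10.ofTest O η) = ∫ x : O, η x ∂a - ∫ x : O, η x ∂b) := by
    intro w
    by_cases hw : energySublinear O ψ w ≤ y
    · obtain ⟨a, b, ha, hb, hab⟩ := hM w hw
      exact ⟨a, b, ha, hb, fun _ => hab⟩
    -- Zero measures off the sublevel set make the mass bound hold for every `w`; the ultrafilter
    -- does not see them.
    · exact ⟨0, 0, by simp, by simp, fun h => absurd h hw⟩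
  choose a b ha hb hab using hM'
  obtain ⟨ν, hν, hνlim⟩ := exists_tendsto_integral_of_ultrafilter U a M ha
  obtain ⟨ν', hν', hνlim'⟩ := exists_tendsto_integral_of_ultrafilter U b M hb
  have hgiven : IsGivenByMeasure u (ν.toSignedMeasure - ν'.toSignedMeasure) := by
    intro η
    obtain ⟨c, hc⟩ := testFunction_exists_abs_le η
    rw [integral_toSignedMeasure_sub ν ν' (testFunction_measurable η) hc]
    have h1 : Tendsto (fun w : HNegOne O => w (H10.ofTest O η)) U (𝓝 (u (H10.ofTest O η))) :=
      ((ContinuousLinearMap.apply ℝ ℝ (H10.ofTest O η)).continuous.tendsto u).mono_left hUu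
    have h2 := (hνlim (testFunctionRestrict η)).sub (hνlim' (testFunctionRestrict η))
    refine tendsto_nhds_unique h1 (h2.congr' ?_)
    filter_upwards [hUy] with w hw
    exact (hab w hw η).symm
  rw [energySublinear_eq_dualEnergy hψ hR ⟨_, hgiven⟩] at hyu
  have hev : ∀ᶠ w in (U : Filter (HNegOne O)), y < dualEnergy ψ w :=
    hUu (lowerSemicontinuous_dualEnergy ψ u y hyu)
  obtain ⟨w, hw1, hw2⟩ := (hev.and hUy).exists
  exact absurd (hw1.trans_le (dualEnergy_le_energySublinear hψ hR w)) (not_lt.2 hw2)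

end Energy

/-! ### Approximation of superlinear potentials by sublinear ones -/

section Truncation

variable {ψ : ℝ → ℝ}

/-- Slopes and negated intercepts of the affine minorants of `ψ` with slope in `[-n, n]`. -/
def affineMinorants (ψ : ℝ → ℝ) (n : ℕ) : Set (ℝ × ℝ) :=
  {p | |p.1| ≤ n ∧ ∀ y, p.1 * y - p.2 ≤ ψ y}

/-- The supremum of the affine minorants of `ψ` with slope in `[-n, n]`. -/
noncomputable def truncatedPotential (ψ : ℝ → ℝ) (n : ℕ) (x : ℝ) : ℝ :=
  sSup ((fun p : ℝ × ℝ => p.1 * x - p.2) '' affineMinorants ψ n)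

theorem le_truncatedPotential {n : ℕ} {p : ℝ × ℝ} (hp : p ∈ affineMinorants ψ n) (x : ℝ) :
    p.1 * x - p.2 ≤ truncatedPotential ψ n x :=
  le_csSup ⟨ψ x, by rintro _ ⟨q, hq, rfl⟩; exact hq.2 x⟩ (mem_image_of_mem _ hp)

namespace IsPotential

theorem zero_mem_affineMinorants (hψ : IsPotential ψ) (n : ℕ) :
    (0 : ℝ × ℝ) ∈ affineMinorants ψ n :=
  ⟨by simp, fun y => by simpa using hψ.nonneg y⟩

theorem truncatedPotential_le_of_forall (hψ : IsPotential ψ) {n : ℕ} {x c : ℝ}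
    (h : ∀ p ∈ affineMinorants ψ n, p.1 * x - p.2 ≤ c) : truncatedPotential ψ n x ≤ c :=
  csSup_le ⟨_, mem_image_of_mem _ (hψ.zero_mem_affineMinorants n)⟩
    (by rintro _ ⟨p, hp, rfl⟩; exact h p hp)

theorem truncatedPotential_le (hψ : IsPotential ψ) (n : ℕ) (x : ℝ) :
    truncatedPotential ψ n x ≤ ψ x :=
  hψ.truncatedPotential_le_of_forall fun _ hp => hp.2 x

theorem truncatedPotential_mono (hψ : IsPotential ψ) {m n : ℕ} (hmn : m ≤ n) (x : ℝ) :
    truncatedPotential ψ m x ≤ truncatedPotential ψ n x :=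
  hψ.truncatedPotential_le_of_forall fun _ hp =>
    le_truncatedPotential ⟨hp.1.trans (by exact_mod_cast hmn), hp.2⟩ x

/-- The tangent line at `x` is then one of the admissible affine minorants. -/
theorem truncatedPotential_eq (hψ : IsPotential ψ) {n : ℕ} {x : ℝ} (hn : |subgradient ψ x| ≤ n) :
    truncatedPotential ψ n x = ψ x := by
  refine le_antisymm (hψ.truncatedPotential_le n x) ?_
  have hp : (subgradient ψ x, subgradient ψ x * x - ψ x) ∈ affineMinorants ψ n :=
    ⟨hn, fun y => by
      have := hψ.subgradient_le x y
      change subgradient ψ x * y - (subgradient ψ x * x - ψ x) ≤ ψ y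
      linarith⟩
  have := le_truncatedPotential hp x
  simpa using this

theorem isPotential_truncatedPotential (hψ : IsPotential ψ) (n : ℕ) :
    IsPotential (truncatedPotential ψ n) := by
  have hnn : ∀ x, 0 ≤ truncatedPotential ψ n x := fun x => by
    simpa using le_truncatedPotential (hψ.zero_mem_affineMinorants n) x
  have hconv : ConvexOn ℝ univ (truncatedPotential ψ n) := by
    refine ⟨convex_univ, fun x _ y _ a b ha hb hab => ?_⟩
    refine hψ.truncatedPotential_le_of_forall fun p hp => ?_
    have h1 := mul_le_mul_of_nonneg_left (le_truncatedPotential hp x) ha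
    have h2 := mul_le_mul_of_nonneg_left (le_truncatedPotential hp y) hb
    have h3 : p.2 = a * p.2 + b * p.2 := by rw [← add_mul, hab, one_mul]
    simp only [smul_eq_mul]
    linarith
  have hsymm : ∀ x, truncatedPotential ψ n (-x) ≤ truncatedPotential ψ n x := by
    intro x
    refine hψ.truncatedPotential_le_of_forall fun p hp => ?_
    have hq : (-p.1, p.2) ∈ affineMinorants ψ n := by
      refine ⟨by simpa using hp.1, fun y => ?_⟩
      have := hp.2 (-y)
      rw [hψ.symm] at this
      simpa using this
    have := le_truncatedPotential hq x
    simpa using this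
  refine ⟨hnn, hconv, hconv.locallyLipschitz.continuous.lowerSemicontinuous, ?_, fun x => ?_⟩
  · exact le_antisymm ((hψ.truncatedPotential_le n 0).trans hψ.map_zero.le) (hnn 0)
  · refine le_antisymm (hsymm x) ?_
    have := hsymm (-x)
    rwa [neg_neg] at this

theorem isSublinear_truncatedPotential (hψ : IsPotential ψ) (n : ℕ) :
    IsSublinear (truncatedPotential ψ n) := by
  refine ⟨n + 1, by positivity, fun x => hψ.truncatedPotential_le_of_forall fun p hp => ?_⟩
  have h0 : 0 ≤ p.2 := by
    have := hp.2 0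
    rw [hψ.map_zero] at this
    linarith
  have h1 : p.1 * x ≤ n * |x| := (le_abs_self _).trans ((abs_mul _ _).le.trans
    (mul_le_mul_of_nonneg_right hp.1 (abs_nonneg x)))
  have h2 := abs_nonneg x
  have h3 : (0 : ℝ) ≤ n := n.cast_nonneg
  linarith

theorem exists_mul_lt_of_isSuperlinear (hs : IsSuperlinear ψ) (K : ℝ) :
    ∃ x, 0 < x ∧ K * x < ψ x := by
  have h1 := (hs.mono_left atTop_le_cocompact).eventually (eventually_gt_atTop K)
  obtain ⟨x, hx, hx0⟩ := (h1.and (eventually_gt_atTop 0)).exists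
  rw [abs_of_pos hx0, lt_div_iff₀ hx0] at hx
  exact ⟨x, hx0, hx⟩

/-- A superlinear potential is the limit of an increasing sequence of sublinear potentials whose
slopes at infinity are unbounded. -/
theorem exists_sublinear_approximation (hψ : IsPotential ψ) (hs : IsSuperlinear ψ) :
    ∃ (Ψ : ℕ → ℝ → ℝ) (R : ℕ → ℝ), (∀ n, IsPotential (Ψ n)) ∧ (∀ n, IsRecessionSlope (Ψ n) (R n)) ∧
      Monotone Ψ ∧ (∀ n x, Ψ n x ≤ ψ x) ∧ (∀ x, ∃ n, Ψ n x = ψ x) ∧ ∀ K, ∃ n, K < R n := by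
  obtain ⟨y, hy0, hy⟩ := exists_mul_lt_of_isSuperlinear hs 0
  rw [zero_mul] at hy
  -- Starting the sequence at `N` makes every truncation positive at `y`, as a positive slope at
  -- infinity requires.
  obtain ⟨N, hN⟩ := exists_nat_ge |subgradient ψ y|
  have heq : ∀ x, ∃ n, truncatedPotential ψ (N + n) x = ψ x := by
    intro x
    obtain ⟨n, hn⟩ := exists_nat_ge |subgradient ψ x|
    refine ⟨n, hψ.truncatedPotential_eq (hn.trans ?_)⟩
    exact_mod_cast Nat.le_add_left n N
  have hpos : ∀ n, ∃ y : ℝ, 0 < y ∧ 0 < truncatedPotential ψ (N + n) y := fun n => by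
    refine ⟨y, hy0, ?_⟩
    rwa [hψ.truncatedPotential_eq (hN.trans (by exact_mod_cast Nat.le_add_right N n))]
  choose R hR using fun n => (hψ.isPotential_truncatedPotential (N + n)).exists_isRecessionSlope
    (hψ.isSublinear_truncatedPotential (N + n)) (hpos n)
  refine ⟨fun n => truncatedPotential ψ (N + n), R,
    fun n => hψ.isPotential_truncatedPotential _, hR,
    fun m n hmn x => hψ.truncatedPotential_mono (by omega) x,
    fun n x => hψ.truncatedPotential_le _ x, heq, fun K => ?_⟩
  obtain ⟨x, hx0, hx⟩ := exists_mul_lt_of_isSuperlinear hs K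
  obtain ⟨n, hn⟩ := heq x
  refine ⟨n, ?_⟩
  have h1 := (hR n).le x
  rw [hn, abs_of_pos hx0] at h1
  exact lt_of_mul_lt_mul_right (hx.trans_le h1) hx0.le

end IsPotential

end Truncation

/-! ### The superlinear energy as a supremum of sublinear energies -/

section Superlinear

variable {d : ℕ} {O : Opens (Rd d)} {ψ : ℝ → ℝ}

theorem iSup_lintegral_ofReal_eq {X : Type*} [MeasurableSpace X] (m : Measure X)
    {Ψ : ℕ → ℝ → ℝ} (hΨ : ∀ n, IsPotential (Ψ n)) (hmono : Monotone Ψ)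
    (hle : ∀ n x, Ψ n x ≤ ψ x) (heq : ∀ x, ∃ n, Ψ n x = ψ x) {f : X → ℝ} (hf : Measurable f) :
    ⨆ n, ∫⁻ x, ENNReal.ofReal (Ψ n (f x)) ∂m = ∫⁻ x, ENNReal.ofReal (ψ (f x)) ∂m := by
  have hmeas : ∀ n, Measurable fun x => ENNReal.ofReal (Ψ n (f x)) := fun n =>
    ((hΨ n).continuous.measurable.comp hf).ennreal_ofReal
  rw [← lintegral_iSup hmeas
    fun m n hmn x => ENNReal.ofReal_le_ofReal (hmono hmn (f x))]
  refine lintegral_congr fun x => le_antisymm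
    (iSup_le fun n => ENNReal.ofReal_le_ofReal (hle n (f x))) ?_
  obtain ⟨n, hn⟩ := heq (f x)
  exact le_iSup_of_le n (by rw [hn])

variable [IsFiniteMeasure (vol O)]

/-- If the energies of `u` for sublinear potentials that increase to the superlinear potential `ψ`
are bounded, then `u` is given by a function `v` with `ψ(v) ∈ L¹(O)`. -/
theorem exists_isGivenByFunction_of_bounded (hψ : IsPotential ψ)
    {Ψ : ℕ → ℝ → ℝ} {R : ℕ → ℝ} (hΨ : ∀ n, IsPotential (Ψ n))
    (hR : ∀ n, IsRecessionSlope (Ψ n) (R n)) (hmono : Monotone Ψ) (hle : ∀ n x, Ψ n x ≤ ψ x)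
    (heq : ∀ x, ∃ n, Ψ n x = ψ x) (hRtop : ∀ K, ∃ n, K < R n) {u : HNegOne O} {K : ℝ≥0∞}
    (hK : K ≠ ∞) (hu : ∀ n, energySublinear O (Ψ n) u ≤ K) :
    ∃ f : O → ℝ, Measurable f ∧ Integrable (fun x => ψ (f x)) (vol O) ∧
      IsGivenByFunction u f := by
  have hex := exists_isGivenByMeasure_of_energySublinear_ne_top (ne_top_of_le_ne_top hK (hu 0))
  obtain ⟨μ, hμ⟩ := id hex
  obtain ⟨l, h, k, H⟩ := exists_hasDensities μ (vol O)
  have hm := H.measurable_left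
  have hk := H.measurable_right
  have hbound : ∀ n, ∫⁻ x, ENNReal.ofReal (perspective (Ψ n) (R n) (h x) (k x)) ∂l ≤ K := by
    intro n
    rw [← H.dualEnergy_eq (hΨ n) (hR n) hμ, ← energySublinear_eq_dualEnergy (hΨ n) (hR n) hex]
    exact hu n
  set Z : Set O := {x | k x = 0}
  have hZ : MeasurableSet Z := hk (measurableSet_singleton 0)
  -- No singular part: on `k = 0` the perspective of `Ψ n` is `R n * |h|`, so `R n * J ≤ K` for all
  -- `n` with `R n` unbounded, which forces `J = 0`.
  have hsing : ∀ᵐ x ∂l, k x = 0 → h x = 0 := by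
    have h0 : ∫⁻ x in Z, ENNReal.ofReal |h x| ∂l = 0 := by
      set J := ∫⁻ x in Z, ENNReal.ofReal |h x| ∂l
      have hJ : ∀ n, ENNReal.ofReal (R n) * J ≤ K := by
        intro n
        refine le_trans ?_ (hbound n)
        rw [← lintegral_const_mul _ (by fun_prop)]
        refine le_trans (le_of_eq ?_) (setLIntegral_le_lintegral Z _)
        refine setLIntegral_congr_fun hZ fun x hx => ?_
        have hx0 : k x = 0 := hx
        simp only [perspective, hx0, if_true]
        rw [ENNReal.ofReal_mul (hR n).pos.le]
      by_contra hJ0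
      obtain ⟨n, hn⟩ := hRtop (K / J).toReal
      have hKJ : K / J ≠ ∞ := ENNReal.div_ne_top hK hJ0
      have hJtop : J ≠ ∞ := by
        intro htop
        have := hJ 0
        rw [htop, ENNReal.mul_top (by simpa using (hR 0).pos)] at this
        exact hK (top_le_iff.1 this)
      have h1 : K / J < ENNReal.ofReal (R n) := by
        rw [← ENNReal.ofReal_toReal hKJ]
        exact (ENNReal.ofReal_lt_ofReal_iff (hR n).pos).2 hn
      rw [ENNReal.div_lt_iff (Or.inl hJ0) (Or.inl hJtop)] at h1
      exact absurd (hJ n) (not_le.2 h1)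
    rw [lintegral_eq_zero_iff (by fun_prop), Filter.EventuallyEq, ae_restrict_iff' hZ] at h0
    filter_upwards [h0] with x hx hx0
    simpa using hx hx0
  set f : O → ℝ := fun x => h x / k x
  have hf : Measurable f := hm.div hk
  have hbound' : ∀ n, ∫⁻ x, ENNReal.ofReal (Ψ n (f x)) ∂(vol O) ≤ K := by
    intro n
    have hmeas : Measurable fun x => ENNReal.ofReal (Ψ n (f x)) :=
      ((hΨ n).continuous.measurable.comp hf).ennreal_ofReal
    rw [H.lintegral_eq hmeas]
    refine (lintegral_mono fun x => ?_).trans (hbound n)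
    change ENNReal.ofReal (Ψ n (h x / k x)) * _ ≤ ENNReal.ofReal (perspective _ _ _ _)
    rcases eq_or_ne (k x) 0 with h0 | h0
    · simp [h0]
    · rw [perspective, if_neg h0, ENNReal.ofReal_mul (H.nonneg x), mul_comm]
  refine ⟨f, hf, ?_, fun η => ?_⟩
  · refine ⟨(hψ.continuous.measurable.comp hf).aestronglyMeasurable, ?_⟩
    rw [hasFiniteIntegral_iff_ofReal (Eventually.of_forall fun x => hψ.nonneg _),
      ← iSup_lintegral_ofReal_eq (vol O) hΨ hmono hle heq hf]
    exact (iSup_le hbound').trans_lt hK.lt_top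
  · obtain ⟨c, hc⟩ := testFunction_exists_abs_le η
    rw [hμ η, H.integral_eq _ (testFunction_measurable η) c hc, ← H.withDensity_eq,
      integral_withDensity_eq_integral_toReal_smul (by fun_prop) (by simp)]
    refine integral_congr_ae ?_
    filter_upwards [hsing] with x hx
    rw [ENNReal.toReal_ofReal (H.nonneg x), smul_eq_mul]
    rcases eq_or_ne (k x) 0 with h0 | h0
    · rw [hx h0, h0]
      ring
    · simp only [f]
      field_simp

theorem energySuperlinear_eq_iSup (hψ : IsPotential ψ) {m : ℝ} (hm : 0 < m)
    (hint : HasIntegrabilityExponent O ψ m) {Ψ : ℕ → ℝ → ℝ} {R : ℕ → ℝ}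
    (hΨ : ∀ n, IsPotential (Ψ n)) (hR : ∀ n, IsRecessionSlope (Ψ n) (R n)) (hmono : Monotone Ψ)
    (hle : ∀ n x, Ψ n x ≤ ψ x) (heq : ∀ x, ∃ n, Ψ n x = ψ x) (hRtop : ∀ K, ∃ n, K < R n)
    (u : HNegOne O) : energySuperlinear O ψ m u = ⨆ n, energySublinear O (Ψ n) u := by
  by_cases hu : ∃ v : Lp ℝ (ENNReal.ofReal (m + 1)) (vol O), IsGivenByFunction u v
  · rw [energySuperlinear, dif_pos hu]
    set v := hu.choose
    have hv : IsGivenByFunction u v := hu.choose_spec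
    have hvm : Measurable v := (Lp.stronglyMeasurable v).measurable
    -- The exponent `m + 1` is at least `1` and `O` has finite volume, so `v dx` is a finite signed
    -- measure, with `l = dx` and `k = 1`.
    have hvi : Integrable v (vol O) := (Lp.memLp v).integrable (by
      rw [ENNReal.one_le_ofReal]; linarith)
    obtain ⟨μ, H⟩ := exists_hasDensities_self (vol O) hvm hvi
    have hμ : IsGivenByMeasure u μ := by
      intro η
      obtain ⟨c, hc⟩ := testFunction_exists_abs_le η
      rw [H.integral_eq _ (testFunction_measurable η) c hc, hv η]
      simp only [mul_comm]
    rw [← iSup_lintegral_ofReal_eq (vol O) hΨ hmono hle heq hvm]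
    congr 1
    ext n
    rw [energySublinear_eq_dualEnergy (hΨ n) (hR n) ⟨μ, hμ⟩, H.dualEnergy_eq (hΨ n) (hR n) hμ]
    simp [perspective]
  · rw [energySuperlinear, dif_neg hu]
    -- If the supremum were finite, it would serve as the uniform energy bound, and `u` would be
    -- given by some `f` with `ψ(f) ∈ L¹`, hence `f ∈ L^{m+1}`.
    by_contra hne
    obtain ⟨f, hf, hfi, hfu⟩ := exists_isGivenByFunction_of_bounded hψ hΨ hR hmono hle heq hRtop
      (Ne.symm hne) fun n => le_iSup (fun n => energySublinear O (Ψ n) u) n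
    have hmem := (hint f hf.aestronglyMeasurable).1 hfi
    refine hu ⟨hmem.toLp f, fun η => ?_⟩
    rw [hfu η]
    refine integral_congr_ae ?_
    filter_upwards [hmem.coeFn_toLp] with x hx
    rw [hx]

theorem convexOn_and_lowerSemicontinuous_energySuperlinear (hψ : IsPotential ψ) {m : ℝ}
    (hm : 0 < m) (hs : IsSuperlinear ψ) (hint : HasIntegrabilityExponent O ψ m) :
    ConvexOn ℝ≥0 univ (energySuperlinear O ψ m) ∧
      LowerSemicontinuous (energySuperlinear O ψ m) := by
  obtain ⟨Ψ, R, hΨ, hR, hmono, hle, heq, hRtop⟩ := hψ.exists_sublinear_approximation hs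
  have hfun : energySuperlinear O ψ m = fun u => ⨆ n, energySublinear O (Ψ n) u :=
    funext (energySuperlinear_eq_iSup hψ hm hint hΨ hR hmono hle heq hRtop)
  rw [hfun]
  refine ⟨⟨convex_univ, fun u hu w hw a b ha hb hab => iSup_le fun n => ?_⟩,
    lowerSemicontinuous_iSup fun n => lowerSemicontinuous_energySublinear (hΨ n) (hR n)⟩
  refine ((convexOn_energySublinear (hΨ n) (hR n)).2 hu hw ha hb hab).trans ?_
  simp only [ENNReal.smul_def, smul_eq_mul]
  gcongr
  · exact le_iSup (fun n => energySublinear O (Ψ n) u) n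
  · exact le_iSup (fun n => energySublinear O (Ψ n) w) n

end Superlinear

theorem proposition3 {d : ℕ} (hd : 1 ≤ d) (O : Opens (Rd d))
    (hO : Bornology.IsBounded (O : Set (Rd d))) (ψ : ℝ → ℝ) (hψ : IsPotential ψ) :
    (∀ m : ℝ, 0 < m → m ≤ 1 → IsSuperlinear ψ → HasIntegrabilityExponent O ψ m →
      ConvexOn ℝ≥0 univ (energySuperlinear O ψ m) ∧
      LowerSemicontinuous (energySuperlinear O ψ m)) ∧
    (IsSublinear ψ → (∃ y : ℝ, 0 < y ∧ 0 < ψ y) →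
      (∀ μ : SignedMeasure O, ∃! ν : Measure O, IsConvexFunctionOfMeasure ψ μ ν) ∧
      ConvexOn ℝ≥0 univ (energySublinear O ψ) ∧
      LowerSemicontinuous (energySublinear O ψ)) := by
  have := isFiniteMeasure_vol hO
  refine ⟨fun m hm _ hs hint => convexOn_and_lowerSemicontinuous_energySuperlinear hψ hm hs hint,
    fun hs hy => ?_⟩
  obtain ⟨R, hR⟩ := hψ.exists_isRecessionSlope hs hy
  exact ⟨existsUnique_isConvexFunctionOfMeasure hψ hR, convexOn_energySublinear hψ hR,
    lowerSemicontinuous_energySublinear hψ hR⟩
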